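/- **Definitions.** For $H:\mathbb R\to\mathbb R$ put $H^{-1}(y)=\inf\{x\in\mathbb R: H(x)>y\}$. The function $H$ satisfies condition $(\mathbb U)$ if (1) $H(x)\to+\infty$ as $x\to+\infty$; (2) $H$ is eventually nondecreasing and differentiable; (3) for some $\kappa\in\mathbb R$ the derivative $\hat h(y)=(H^{-1})'(y)=1/H'(H^{-1}(y))$, defined for large $y$, is regularly varying at $+\infty$ with index $\kappa$, i.e. it is positive and measurable near $+\infty$ and $\hat h(y)=y^{\kappa}V(y)$ with $V(ty)/V(y)\to 1$ as $y\to\infty$ for every $t>0$. Let $X=(X(t))_{t\ge 0}$ be a real-valued regenerative process: $X(t)=\xi_k(t-S_{k-1})$ for $t\in[S_{k-1},S_k)$, $k\ge 1$, where $S_0=0$, $S_k=T_1+\dots+T_k$, and $(T_k,\xi_k(\cdot))_{k\ge 1}$ are independent copies of a pair $(T,\xi(\cdot))$ with $T\ge 0$. Put $\bar X(t)=\sup_{0\le s<t}X(s)$ (an extended real) and $\alpha_T=\mathbf E T$. **Theorem.** Suppose that $\mathbf P(X(t)\in\{0,1,2,\dots\})=1$ for every $t\ge 0$ and that $\alpha_T<\infty$.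 For $k=0,1,2,\dots$ let $R_k=-\log \mathbf P(\bar X(T_1)>k)$, and suppose that there are functions $R_0,R_1:\mathbb R\to\mathbb R$ and a constant $C_1<\infty$ such that $R_k=R_0(k)+R_1(k)$ and $|R_1(k)|\le C_1$ for all $k=0,1,2,\dots$, and such that $R_0$ satisfies condition $(\mathbb U)$. Let $r_0=R_0'$ (defined for large arguments) and $A_0(t)=R_0^{-1}(\log (t/\alpha_T))$. (i) If $r_0(R_0^{-1}(x))=o(\log x)$ as $x\to\infty$, then $$\limsup_{t\to\infty}\frac{r_0(A_0(t))\,(\bar X(t)-A_0(t))}{\log\log t}=1\quad\text{a.s.}$$ (ii) If $r_0(R_0^{-1}(x))=o(\log\log x)$ as $x\to\infty$, then $$\liminf_{t\to\infty}\frac{r_0(A_0(t))\,(\bar X(t)-A_0(t))}{\log\log\log t}=-1\quad\text{a.s.}$$ -/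

import Mathlib

open MeasureTheory ProbabilityTheory Filter Topology Asymptotics
open scoped NNReal

noncomputable section

/-- `V` is slowly varying at `+∞`. -/
def SlowlyVarying (V : ℝ → ℝ) : Prop :=
  ∀ x : ℝ, 0 < x → Tendsto (fun t : ℝ => V (t * x) / V t) atTop (𝓝 1)

/-- `U` is positive and measurable in a neighbourhood of `+∞`, and regularly varying at `+∞`
with index `κ`: there `U x = x ^ κ * V x` with `V` slowly varying. -/
def RegularlyVarying (U : ℝ → ℝ) (κ : ℝ) : Prop :=
  ∃ a : ℝ, (∀ x, a < x → 0 < U x) ∧ Measurable (fun x : Set.Ioi a => U x) ∧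
    ∃ V : ℝ → ℝ, SlowlyVarying V ∧ ∀ᶠ x in atTop, U x = x ^ κ * V x

/-- The generalized inverse `H⁻¹(y) = inf {x : H x > y}`. -/
def genInv (H : ℝ → ℝ) (y : ℝ) : ℝ := sInf {x : ℝ | y < H x}

/-- Condition (U): `H → +∞`, `H` is eventually nondecreasing and differentiable, and the derivative
`ĥ(y) = (H⁻¹)'(y) = 1 / H'(H⁻¹(y))` of the generalized inverse (for large `y`) is regularly
varying at `+∞` with some real index. -/
structure ConditionU (H : ℝ → ℝ) : Prop where
  tendsto : Tendsto H atTop atTop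
  eventually_mono_diff :
    ∃ x₀ : ℝ, MonotoneOn H (Set.Ici x₀) ∧ ∀ x, x₀ ≤ x → DifferentiableAt ℝ H x
  hasDerivAt_inv :
    ∀ᶠ y in atTop, HasDerivAt (genInv H) (1 / deriv H (genInv H y)) y
  regularlyVarying :
    ∃ κ : ℝ, RegularlyVarying (fun y => 1 / deriv H (genInv H y)) κ

/-- The running supremum `sup_{0 ≤ s < t} x(s)` of a path, as an extended real
(`-∞` for the empty supremum, `+∞` for a path unbounded above on `[0, t)`). -/
def runningSup (x : ℝ≥0 → ℝ) (t : ℝ≥0) : EReal :=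
  ⨆ (s : ℝ≥0) (_ : s < t), (x s : EReal)

/-- A regeneration cycle `(T, ξ(·))`. -/
structure RegenCycle where
  /-- the duration `T` of the cycle -/
  duration : ℝ≥0
  /-- the path `ξ(·)` -/
  path : ℝ≥0 → ℝ

/-- The sigma-algebra on cycles: the smallest one for which the duration, the value of the path at
each fixed time, and the cycle maximum `sup_{0 ≤ s < T} ξ(s)` are measurable. The last requirement
makes the cycle maximum a random variable; it is not automatic, being an uncountable supremum. -/
instance RegenCycle.instMeasurableSpace : MeasurableSpace RegenCycle :=
  MeasurableSpace.comap RegenCycle.duration inferInstance ⊔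
    MeasurableSpace.comap RegenCycle.path inferInstance ⊔
    MeasurableSpace.comap (fun c : RegenCycle => runningSup c.path c.duration) inferInstance

/-- The regeneration epochs: `S 0 = 0` and `S k = T₁ + ⋯ + T_k`, where the `k`-th cycle
(`k = 1, 2, …`) is `c (k - 1)`. -/
def epoch {Ω : Type*} (c : ℕ → Ω → RegenCycle) (k : ℕ) (ω : Ω) : ℝ≥0 :=
  ∑ i ∈ Finset.range k, (c i ω).duration

/-- `X` is a regenerative process with the sequence `c` of cycles `(T_k, ξ_k(·))`: these are
independent and identically distributed, and (almost surely)
`X(t) = ξ_k (t - S_{k-1})` for `t ∈ [S_{k-1}, S_k)`. -/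
structure IsRegenerative {Ω : Type*} [MeasurableSpace Ω] (P : Measure Ω)
    (X : ℝ≥0 → Ω → ℝ) (c : ℕ → Ω → RegenCycle) : Prop where
  indep : iIndepFun c P
  identDistrib : ∀ k, IdentDistrib (c k) (c 0) P P
  eq_cycle : ∀ᵐ ω ∂P, ∀ (k : ℕ) (t : ℝ≥0), epoch c k ω ≤ t → t < epoch c (k + 1) ω →
    X t ω = (c k ω).path (t - epoch c k ω)

/-- The mean cycle length `α_T = E T₁`. -/
def meanDuration {Ω : Type*} [MeasurableSpace Ω] (P : Measure Ω) (c : ℕ → Ω → RegenCycle) : ℝ :=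
  ∫ ω, ((c 0 ω).duration : ℝ) ∂P

/-- `R_k = -log P(sup_{0 ≤ s < T₁} X(s) > k)`. -/
def tailExponent {Ω : Type*} [MeasurableSpace Ω] (P : Measure Ω) (X : ℝ≥0 → Ω → ℝ)
    (c : ℕ → Ω → RegenCycle) (k : ℕ) : ℝ :=
  -Real.log (P.real {ω | ((k : ℝ) : EReal) < runningSup (fun s => X s ω) ((c 0 ω).duration)})

/-- The centering `A₀(t) = R₀⁻¹(log (t / α))`. -/
def centering (R₀ : ℝ → ℝ) (α : ℝ) (t : ℝ) : ℝ := genInv R₀ (Real.log (t / α))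

/-- `L₂(t) = log log t`. -/
def L₂ (t : ℝ) : ℝ := Real.log (Real.log t)

/-- `L₃(t) = log log log t`. -/
def L₃ (t : ℝ) : ℝ := Real.log (Real.log (Real.log t))

/-- The centered and normalized running supremum `r₀(A₀(t)) (sup_{0 ≤ s < t} x(s) - A₀(t)) / L(t)`
of a path, where `r₀ = R₀'`, as an extended real. -/
def normalizedSup (R₀ : ℝ → ℝ) (α : ℝ) (L : ℝ → ℝ) (x : ℝ≥0 → ℝ) (t : ℝ≥0) : EReal :=
  ((deriv R₀ (centering R₀ α t) : ℝ) : EReal) * (runningSup x t - ((centering R₀ α t : ℝ) : EReal)) /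
    ((L t : ℝ) : EReal)

end

/-! Write `g` for the inverse of `R₀`, `y = log (t / α)`, and `l` for `log` in (i), `log log` in
(ii). Regular variation makes `g` nearly linear on the scale `l`: `g (y + c * l y) - g y` is
asymptotic to `c * l y / r₀ (g y)` (`SlowGrowth.tendsto_increment`). Hence a running supremum equal
to `g (y + c * l y)` has normalized value close to `c`, and each claim becomes a question about
which `c` are exceeded.

The cycle maxima are i.i.d., and their tail at `g (y + c * l y)` is `exp (-y - (c + o(1)) * l y)`
(`SlowGrowth.hasTail`): the condition on `r₀` makes the increments of `g` on this scale unbounded,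
so rounding to integers costs only a change of `c`, and the bounded `R₁` is absorbed likewise.

Among `exp y` cycles the expected number of exceedances is thus about `exp (-c * l y)`. Take `y = j
* log 2`. For `l = log` this is `j ^ (-c)` up to a constant, so the Borel–Cantelli lemmas change
regime at `c = 1`. For `l = log log`, no exceedance occurs with probability about `exp (-(log j) ^
(-c))`, and the change is at `c = -1`.

The strong law puts the `n`-th epoch between `α * n / 2` and `2 * α * n`. Such factors move `y` by a
bounded amount, which again costs only a change of `c`, so the four bounds on maxima pass to the
process. -/

/-! ### Regular variation and local uniformity. -/

/-- The uniform convergence theorem in additive form. -/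
theorem tendsto_add_sub_of_pointwise {f : ℝ → ℝ} (hf : Measurable f)
    (h : ∀ u : ℝ, Tendsto (fun s => f (s + u) - f s) atTop (𝓝 0)) :
    Tendsto (fun p : ℝ × ℝ => f (p.1 + p.2) - f p.1) (atTop ×ˢ 𝓝 0) (𝓝 0) := by
  refine tendsto_of_seq_tendsto fun p hp => ?_
  have hx : Tendsto (fun n => (p n).1) atTop atTop := tendsto_fst.comp hp
  have hu : Tendsto (fun n => (p n).2) atTop (𝓝 0) := tendsto_snd.comp hp
  have hxu : Tendsto (fun n => (p n).1 + (p n).2) atTop atTop := hx.atTop_add hu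
  have key : ∀ x : ℕ → ℝ, Tendsto x atTop atTop →
      TendstoInMeasure (volume.restrict (Set.Icc (-1 : ℝ) 2))
        (fun n u => f (x n + u) - f (x n)) atTop (fun _ => 0) := by
    intro x hx
    refine tendstoInMeasure_of_tendsto_ae (fun n => ?_) (ae_of_all _ fun u => (h u).comp hx)
    exact ((hf.comp (measurable_const_add _)).sub measurable_const).aestronglyMeasurable
  rw [Metric.tendsto_atTop']
  simp only [dist_zero_right]
  intro ε hε
  have h1 := (tendstoInMeasure_iff_norm.1 (key _ hx)) (ε / 2) (by positivity)
  have h2 := (tendstoInMeasure_iff_norm.1 (key _ hxu)) (ε / 2) (by positivity)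
  have h3 : (0 : ENNReal) < ENNReal.ofReal (1 / 3) := by simp
  have h4 : ∀ᶠ n in atTop, |(p n).2| < 1 := by
    have := hu.abs
    simp only [abs_zero] at this
    exact this.eventually_lt_const one_pos
  obtain ⟨N, hN⟩ := eventually_atTop.1
    ((h1.eventually_lt_const h3).and ((h2.eventually_lt_const h3).and h4))
  refine ⟨N, fun n hn => ?_⟩
  obtain ⟨ha, hb, hc⟩ := hN n hn.le
  rw [abs_lt] at hc
  simp only [sub_zero] at ha hb
  set A := {x | ε / 2 ≤ ‖f ((p n).1 + x) - f (p n).1‖} with hA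
  set B := {x | ε / 2 ≤ ‖f ((p n).1 + (p n).2 + x) - f ((p n).1 + (p n).2)‖} with hB
  -- Inside `[-1, 2]` both bad sets have measure below `1/3`, so they cannot cover `[0, 1]` even
  -- after a translation by less than `1`. A good `u` compares `f` at both base points with its
  -- value at the same point `(p n).1 + u`.
  have hex : ∃ u ∈ Set.Icc (0 : ℝ) 1, u ∉ A ∧ u - (p n).2 ∉ B := by
    by_contra! hcon
    have hsub : Set.Icc (0 : ℝ) 1 ⊆ (A ∩ Set.Icc (-1) 2) ∪
        ((fun u => u - (p n).2) ⁻¹' (B ∩ Set.Icc (-1) 2)) := by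
      intro u hu
      by_cases huA : u ∈ A
      · exact Or.inl ⟨huA, by linarith [hu.1], by linarith [hu.2]⟩
      · exact Or.inr ⟨hcon u hu huA, by simp only; linarith [hu.1], by simp only; linarith [hu.2]⟩
    have := (measure_mono (μ := volume) hsub).trans (measure_union_le _ _)
    have htr : volume ((fun u => u - (p n).2) ⁻¹' (B ∩ Set.Icc (-1) 2)) =
        volume (B ∩ Set.Icc (-1) 2) := by
      simp only [sub_eq_add_neg]
      exact measure_preimage_add_right _ _ _
    rw [htr, ← Measure.restrict_apply' measurableSet_Icc,
      ← Measure.restrict_apply' measurableSet_Icc, Real.volume_Icc] at this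
    have h5 := this.trans_lt (ENNReal.add_lt_add ha hb)
    rw [← ENNReal.ofReal_add (by norm_num) (by norm_num),
      ENNReal.ofReal_lt_ofReal_iff (by norm_num)] at h5
    norm_num at h5
  obtain ⟨u, -, huA, huB⟩ := hex
  simp only [hA, hB, Set.mem_ofPred_eq, not_le, add_add_sub_cancel, Real.norm_eq_abs,
    Function.comp] at huA huB ⊢
  rw [abs_lt] at *
  constructor <;> linarith [huA.1, huA.2, huB.1, huB.2]

theorem RegularlyVarying.eventually_pos {U : ℝ → ℝ} {κ : ℝ} (h : RegularlyVarying U κ) :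
    ∀ᶠ y in atTop, 0 < U y := by
  obtain ⟨a, ha, -⟩ := h
  exact (eventually_gt_atTop a).mono ha

/-- A regularly varying function is asymptotically unchanged by a rescaling close to `1`. -/
theorem RegularlyVarying.tendsto_mul_div {U : ℝ → ℝ} {κ : ℝ} (h : RegularlyVarying U κ) :
    Tendsto (fun p : ℝ × ℝ => U (p.1 * p.2) / U p.1) (atTop ×ˢ 𝓝 1) (𝓝 1) := by
  obtain ⟨a, ha, hmeas, V, hV, hUV⟩ := h
  -- Eventually this is `log (V (exp s))`, but only `U`, and only on `Ioi a`, is known to be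
  -- measurable.
  set W : ℝ → ℝ := fun s => Real.log ((Set.Ioi a).indicator U (Real.exp s)) - κ * s with hW
  have hWm : Measurable W := by
    have h1 : Measurable ((Set.Ioi a).indicator U) := by
      refine measurable_of_restrict_of_restrict_compl (measurableSet_Ioi (a := a)) ?_ ?_
      · convert hmeas using 2 with x
        exact Set.indicator_of_mem x.2 U
      · convert measurable_const (a := (0 : ℝ)) using 2 with x
        exact Set.indicator_of_notMem x.2 U
    exact (Real.measurable_log.comp (h1.comp Real.measurable_exp)).sub
      (measurable_id.const_mul κ)
  have hWV : ∀ᶠ s in atTop, 0 < V (Real.exp s) ∧ W s = Real.log (V (Real.exp s)) := by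
    filter_upwards [Real.tendsto_exp_atTop.eventually hUV,
      Real.tendsto_exp_atTop.eventually (eventually_gt_atTop a)] with s hs has
    have hpos := ha _ has
    have hk : 0 < Real.exp s ^ κ := Real.rpow_pos_of_pos (Real.exp_pos s) κ
    have hVpos : 0 < V (Real.exp s) := by
      rw [hs] at hpos
      exact pos_of_mul_pos_right hpos hk.le
    refine ⟨hVpos, ?_⟩
    rw [hW]
    simp only [Set.indicator_of_mem (Set.mem_Ioi.2 has)]
    rw [hs, Real.log_mul hk.ne' hVpos.ne', Real.log_rpow (Real.exp_pos s), Real.log_exp]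
    ring
  have hpt : ∀ u : ℝ, Tendsto (fun s => W (s + u) - W s) atTop (𝓝 0) := by
    intro u
    have h1 := (hV (Real.exp u) (Real.exp_pos u)).comp Real.tendsto_exp_atTop
    have h2 := (Real.continuousAt_log one_ne_zero).tendsto.comp h1
    rw [Real.log_one] at h2
    refine h2.congr' ?_
    filter_upwards [hWV, (tendsto_atTop_add_const_right _ u tendsto_id).eventually hWV]
      with s hs hs'
    simp only [id] at hs'
    rw [hs.2, hs'.2, ← Real.log_div hs'.1.ne' hs.1.ne', Real.exp_add]
    rfl
  have huct := tendsto_add_sub_of_pointwise hWm hpt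
  have hmap : Tendsto (fun p : ℝ × ℝ => (Real.log p.1, Real.log p.2))
      (atTop ×ˢ 𝓝 1) (atTop ×ˢ 𝓝 0) := by
    have := (Real.continuousAt_log one_ne_zero).tendsto
    rw [Real.log_one] at this
    exact Real.tendsto_log_atTop.prodMap this
  have hk : Tendsto (fun p : ℝ × ℝ => κ * Real.log p.2) (atTop ×ˢ 𝓝 1) (𝓝 0) := by
    have := ((tendsto_snd.comp hmap).const_mul κ)
    simpa using this
  have h1 := (Real.continuous_exp.tendsto _).comp ((huct.comp hmap).add hk)
  simp only [add_zero, Real.exp_zero] at h1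
  refine h1.congr' ?_
  have hge : ∀ᶠ p : ℝ × ℝ in atTop ×ˢ 𝓝 1, p.1 > max a 0 :=
    tendsto_fst.eventually (eventually_gt_atTop _)
  have hge1 : ∀ᶠ p : ℝ × ℝ in atTop ×ˢ 𝓝 1, (0 : ℝ) < p.2 :=
    tendsto_snd.eventually (lt_mem_nhds one_pos)
  have hprod : Tendsto (fun p : ℝ × ℝ => p.1 * p.2) (atTop ×ˢ 𝓝 1) atTop :=
    tendsto_fst.atTop_mul_pos one_pos tendsto_snd
  filter_upwards [hge, hge1, hprod.eventually (eventually_gt_atTop a)] with p hp hp2 hp3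
  have hp0 : 0 < p.1 := (le_max_right _ _).trans_lt hp
  have hpa : a < p.1 := (le_max_left _ _).trans_lt hp
  simp only [Function.comp, hW]
  rw [Real.exp_add, Real.exp_add (Real.log p.1), Real.exp_log hp0, Real.exp_log hp2, Set.indicator_of_mem (Set.mem_Ioi.2 hp3),
    Set.indicator_of_mem (Set.mem_Ioi.2 hpa), ← Real.exp_add]
  rw [show Real.log (U (p.1 * p.2)) - κ * (Real.log p.1 + Real.log p.2) -
    (Real.log (U p.1) - κ * Real.log p.1) + κ * Real.log p.2 =
    Real.log (U (p.1 * p.2)) - Real.log (U p.1) by ring, Real.exp_sub, Real.exp_log (ha _ hp3),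
    Real.exp_log (ha _ hpa)]

/-! ### Scales, and increments of the inverse function on a scale. -/

/-- The properties of the iterated logarithms used as scales for the fluctuations. -/
structure IsScale (l : ℝ → ℝ) : Prop where
  tendsto : Tendsto l atTop atTop
  isLittleO : l =o[atTop] (fun y => y)
  eventually_near : ∀ K : ℝ, ∀ᶠ y in atTop, ∀ z, |z - y| ≤ K → |l z - l y| ≤ 1

theorem isScale_log : IsScale Real.log where
  tendsto := Real.tendsto_log_atTop
  isLittleO := Real.isLittleO_log_id_atTop
  eventually_near K := by
    filter_upwards [eventually_gt_atTop 0, eventually_ge_atTop (2 * K)] with y hy hK z hz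
    rw [abs_le] at hz
    have hz0 : y / 2 ≤ z := by linarith
    have h2 : Real.log 2 ≤ 1 := by linarith [Real.log_two_lt_d9]
    have h3 := Real.log_le_log (by linarith) (show z ≤ 2 * y by linarith)
    have h4 := Real.log_le_log hy (show y ≤ 2 * z by linarith)
    rw [Real.log_mul two_ne_zero (by linarith)] at h3 h4
    rw [abs_le]
    constructor <;> linarith

theorem isScale_log_log : IsScale (fun y => Real.log (Real.log y)) where
  tendsto := Real.tendsto_log_atTop.comp Real.tendsto_log_atTop
  isLittleO := (isScale_log.isLittleO.comp_tendsto Real.tendsto_log_atTop).trans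
    Real.isLittleO_log_id_atTop
  eventually_near K := by
    filter_upwards [isScale_log.eventually_near K,
      Real.tendsto_log_atTop.eventually (isScale_log.eventually_near 1)] with y h1 h2 z hz
    exact h2 _ (h1 z hz)

theorem IsScale.tendsto_add_mul {l : ℝ → ℝ} (hl : IsScale l) (c : ℝ) :
    Tendsto (fun y => y + c * l y) atTop atTop := by
  have h := ((hl.isLittleO.const_mul_left c).tendsto_div_nhds_zero).const_add 1
  have h1 := (tendsto_id (x := atTop (α := ℝ))).atTop_mul_pos (by norm_num) h
  refine h1.congr' ?_
  filter_upwards [eventually_gt_atTop 0] with y hy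
  simp only [id]
  field_simp

/-- An eventually differentiable function `g` with positive derivative `h` that varies slowly on
the scale `l`, where `h * l → ∞`. -/
structure SlowGrowth (g h l : ℝ → ℝ) : Prop where
  hasDerivAt : ∀ᶠ y in atTop, HasDerivAt g (h y) y
  pos : ∀ᶠ y in atTop, 0 < h y
  tendsto_mul_div : Tendsto (fun p : ℝ × ℝ => h (p.1 * p.2) / h p.1) (atTop ×ˢ 𝓝 1) (𝓝 1)
  tendsto_mul : Tendsto (fun y => h y * l y) atTop atTop

theorem exists_slope_mem_uIcc {g h : ℝ → ℝ} {Y : ℝ} (hg : ∀ y ≥ Y, HasDerivAt g (h y) y)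
    {a b : ℝ} (ha : Y ≤ a) (hb : Y ≤ b) : ∃ θ ∈ Set.uIcc a b, g b - g a = h θ * (b - a) := by
  have key : ∀ a b, Y ≤ a → a < b → ∃ θ ∈ Set.Icc a b, g b - g a = h θ * (b - a) := by
    intro a b ha hab
    obtain ⟨θ, hθ, he⟩ := exists_hasDerivAt_eq_slope g h hab
      (fun x hx => (hg x (ha.trans hx.1)).continuousAt.continuousWithinAt)
      (fun x hx => hg x (ha.trans hx.1.le))
    refine ⟨θ, Set.Ioo_subset_Icc_self hθ, ?_⟩
    rw [he]
    field_simp [sub_ne_zero.2 hab.ne']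
  rcases lt_trichotomy a b with hab | hab | hab
  · rw [Set.uIcc_of_lt hab]; exact key a b ha hab
  · subst hab; exact ⟨a, by simp, by simp⟩
  · obtain ⟨θ, hθ, he⟩ := key b a hb hab
    rw [Set.uIcc_of_gt hab]
    exact ⟨θ, hθ, by linarith⟩

namespace SlowGrowth

variable {g h l : ℝ → ℝ}

theorem exists_strictMonoOn (hg : SlowGrowth g h l) : ∃ Y, StrictMonoOn g (Set.Ici Y) := by
  obtain ⟨Y, hY⟩ := eventually_atTop.1 (hg.hasDerivAt.and hg.pos)
  refine ⟨Y, fun a ha b hb hab => ?_⟩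
  obtain ⟨θ, hθ, he⟩ := exists_slope_mem_uIcc (fun y hy => (hY y hy).1) ha hb
  rw [Set.uIcc_of_lt hab] at hθ
  have := mul_pos (hY θ (le_trans ha hθ.1)).2 (sub_pos.2 hab)
  linarith

/-- Increments of `g` on the scale `l` are asymptotically linear. -/
theorem tendsto_increment (hg : SlowGrowth g h l) (hl : IsScale l) (c : ℝ) :
    Tendsto (fun y => (g (y + c * l y) - g y) / (h y * l y)) atTop (𝓝 c) := by
  obtain ⟨Y, hY⟩ := eventually_atTop.1 hg.hasDerivAt
  have hex : ∀ y, ∃ θ, Y ≤ y → Y ≤ y + c * l y → θ ∈ Set.uIcc y (y + c * l y) ∧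
      g (y + c * l y) - g y = h θ * (y + c * l y - y) := by
    intro y
    by_cases h1 : Y ≤ y ∧ Y ≤ y + c * l y
    · obtain ⟨θ, h2, h3⟩ := exists_slope_mem_uIcc hY h1.1 h1.2
      exact ⟨θ, fun _ _ => ⟨h2, h3⟩⟩
    · exact ⟨0, fun h2 h3 => absurd ⟨h2, h3⟩ h1⟩
  choose θ hθ using hex
  have hev : ∀ᶠ y in atTop, θ y ∈ Set.uIcc y (y + c * l y) ∧
      g (y + c * l y) - g y = h (θ y) * (y + c * l y - y) := by
    filter_upwards [eventually_ge_atTop Y,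
      (hl.tendsto_add_mul c).eventually (eventually_ge_atTop Y)] with y h1 h2
    exact hθ y h1 h2
  -- Since `l y = o(y)`, the mean value point is a rescaling of `y` by a factor tending to `1`,
  -- where `h` is asymptotically unchanged.
  have hratio : Tendsto (fun y => θ y / y) atTop (𝓝 1) := by
    have h0 := ((hl.isLittleO.const_mul_left c).tendsto_div_nhds_zero).abs
    rw [abs_zero] at h0
    rw [tendsto_iff_norm_sub_tendsto_zero]
    refine squeeze_zero' (Eventually.of_forall fun _ => norm_nonneg _) ?_ h0
    filter_upwards [hev, eventually_gt_atTop 0] with y hy hy0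
    have h1 := Set.abs_sub_left_of_mem_uIcc hy.1
    rw [add_sub_cancel_left] at h1
    rw [Real.norm_eq_abs, div_sub_one hy0.ne', abs_div, abs_div]
    gcongr
  have h1 := (hg.tendsto_mul_div.comp (tendsto_id.prodMk hratio)).const_mul c
  rw [mul_one] at h1
  refine h1.congr' ?_
  filter_upwards [hev, eventually_gt_atTop 0, hg.pos, hl.tendsto.eventually_gt_atTop 0]
    with y hy hy0 hh hl0
  simp only [Function.comp, id]
  rw [hy.2, mul_div_cancel₀ _ hy0.ne']
  field_simp
  ring

/-- The difference is asymptotic to `(b - a) * h y * l y`, which tends to infinity. The gap of `1`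
is what absorbs rounding to an integer. -/
theorem eventually_add_one_le (hg : SlowGrowth g h l) (hl : IsScale l) {a b : ℝ} (hab : a < b) :
    ∀ᶠ y in atTop, g (y + a * l y) + 1 ≤ g (y + b * l y) := by
  have h1 := (hg.tendsto_increment hl b).sub (hg.tendsto_increment hl a)
  have h2 := (hg.tendsto_mul.atTop_mul_pos (sub_pos.2 hab) h1).eventually_ge_atTop 1
  filter_upwards [h2, hg.tendsto_mul.eventually_gt_atTop 0] with y hy hy0
  rw [mul_sub, mul_div_cancel₀ _ hy0.ne', mul_div_cancel₀ _ hy0.ne'] at hy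
  linarith

theorem tendsto_atTop (hg : SlowGrowth g h l) (hl : IsScale l) : Tendsto g atTop atTop := by
  obtain ⟨Y, hY⟩ := hg.exists_strictMonoOn
  have h1 := hg.tendsto_mul.atTop_mul_pos one_pos (hg.tendsto_increment hl 1)
  refine Filter.tendsto_atTop.2 fun b => ?_
  obtain ⟨y, hy, hy0, hyY, hyl⟩ := ((h1.eventually_ge_atTop (b - g Y)).and
    ((hg.tendsto_mul.eventually_gt_atTop 0).and ((eventually_ge_atTop Y).and
    ((hl.tendsto_add_mul 1).eventually_ge_atTop Y)))).exists
  rw [mul_div_cancel₀ _ hy0.ne'] at hy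
  filter_upwards [eventually_ge_atTop (y + 1 * l y)] with z hz
  have h2 := hY.monotoneOn hyl (hyl.trans hz) hz
  have h3 := hY.monotoneOn (Set.mem_Ici.2 le_rfl) hyY hyY
  linarith

end SlowGrowth

/-- The little-o condition on the derivative says precisely that `h * l` tends to infinity. -/
theorem ConditionU.slowGrowth {H l : ℝ → ℝ} (hH : ConditionU H) (hl : IsScale l)
    (hlo : (fun x : ℝ => deriv H (genInv H x)) =o[atTop] l) :
    SlowGrowth (genInv H) (fun y => 1 / deriv H (genInv H y)) l := by
  obtain ⟨κ, hκ⟩ := hH.regularlyVarying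
  refine ⟨hH.hasDerivAt_inv, hκ.eventually_pos, hκ.tendsto_mul_div, ?_⟩
  have h1 := hlo.tendsto_div_nhds_zero
  have h2 : Tendsto (fun x => deriv H (genInv H x) / l x) atTop (𝓝[>] 0) := by
    refine tendsto_nhdsWithin_iff.2 ⟨h1, ?_⟩
    filter_upwards [hκ.eventually_pos, hl.tendsto.eventually_gt_atTop 0] with y hy hy0
    exact div_pos (one_div_pos.1 hy) hy0
  refine h2.inv_tendsto_nhdsGT_zero.congr fun y => ?_
  simp [div_eq_mul_inv, mul_comm]

/-- Once the generalized inverse tends to infinity, it is eventually a right inverse. -/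
theorem ConditionU.eventually_apply_genInv {H : ℝ → ℝ} (hH : ConditionU H)
    (hg : Tendsto (genInv H) atTop atTop) : ∀ᶠ y in atTop, H (genInv H y) = y := by
  obtain ⟨x₀, -, hd⟩ := hH.eventually_mono_diff
  filter_upwards [hg.eventually_gt_atTop x₀, hg.eventually_gt_atTop 0] with y hy hy0
  have hne : {x : ℝ | y < H x}.Nonempty := (hH.tendsto.eventually_gt_atTop y).exists
  -- Otherwise `sInf` would take its default value `0`, contradicting `hy0`.
  have hbdd : BddBelow {x : ℝ | y < H x} := by
    by_contra hb
    rw [genInv, Real.sInf_of_not_bddBelow hb] at hy0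
    exact lt_irrefl _ hy0
  have hc : ContinuousAt H (genInv H y) := (hd _ hy.le).continuousAt
  apply le_antisymm
  · have h1 : Tendsto H (𝓝[<] (genInv H y)) (𝓝 (H (genInv H y))) :=
      hc.tendsto.mono_left nhdsWithin_le_nhds
    refine le_of_tendsto h1 ?_
    filter_upwards [self_mem_nhdsWithin] with x hx
    by_contra! hcon
    exact absurd (csInf_le hbdd (show x ∈ {x : ℝ | y < H x} from hcon)) (not_le.2 hx)
  · obtain ⟨u, -, hu, hmem⟩ := exists_seq_tendsto_sInf hne hbdd
    exact ge_of_tendsto (hc.tendsto.comp hu) (Eventually.of_forall fun n => (hmem n).le)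

/-! ### The tail of a cycle maximum along the thresholds. -/

/-- The tail `Q` satisfies `Q (g (y + c * l y)) = exp (-y - (c + o(1)) * l y)` for all `c`. -/
def HasTail (Q g l : ℝ → ℝ) : Prop :=
  ∀ c c' : ℝ, (c < c' → ∀ᶠ y in atTop, Real.exp (-(y + c' * l y)) ≤ Q (g (y + c * l y))) ∧
    (c' < c → ∀ᶠ y in atTop, Q (g (y + c * l y)) ≤ Real.exp (-(y + c' * l y)))

/-- The exponent is known only at integers, so monotonicity of `Q` is used to round the threshold up
or down. With `b` between `c` and `c'`, the rounded threshold does not pass `g (y + b * l y)`, where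
`R₀` equals `y + b * l y`; the remaining gap between `b` and `c'`, multiplied by `l y`, exceeds the
bound `C` on `R₁`. -/
theorem SlowGrowth.hasTail {g h l Q R₀ R₁ : ℝ → ℝ} {C x₀ : ℝ} (hg : SlowGrowth g h l)
    (hl : IsScale l) (hR₀ : MonotoneOn R₀ (Set.Ici x₀)) (hinv : ∀ᶠ y in atTop, R₀ (g y) = y)
    (hQ : Antitone Q) (hQR : ∀ k : ℕ, Q k = Real.exp (-(R₀ k + R₁ k)))
    (hR₁ : ∀ k : ℕ, |R₁ k| ≤ C) : HasTail Q g l := by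
  have hg' := hg.tendsto_atTop hl
  refine fun c c' => ⟨fun hc => ?_, fun hc => ?_⟩
  · obtain ⟨b, hcb, hbc'⟩ := exists_between hc
    filter_upwards [hg.eventually_add_one_le hl hcb,
      (hl.tendsto_add_mul b).eventually hinv,
      (hg'.comp (hl.tendsto_add_mul c)).eventually_ge_atTop (max x₀ 0),
      (hl.tendsto.const_mul_atTop (sub_pos.2 hbc')).eventually_ge_atTop C] with y h1 h2 h3 h4
    simp only [Function.comp] at h3
    have h3x := (le_max_left _ _).trans h3
    have h30 := (le_max_right _ _).trans h3
    have hceil := Nat.ceil_lt_add_one h30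
    have hle := Nat.le_ceil (g (y + c * l y))
    refine le_trans ?_ (hQ hle)
    rw [hQR]
    refine Real.exp_le_exp.2 ?_
    have h5 := hR₀ (Set.mem_Ici.2 (h3x.trans hle))
      (Set.mem_Ici.2 (h3x.trans (by linarith))) (hceil.le.trans h1)
    have h6 := (abs_le.1 (hR₁ ⌈g (y + c * l y)⌉₊)).2
    linarith
  · obtain ⟨b, hcb, hbc'⟩ := exists_between hc
    filter_upwards [hg.eventually_add_one_le hl hbc',
      (hl.tendsto_add_mul b).eventually hinv,
      (hg'.comp (hl.tendsto_add_mul b)).eventually_ge_atTop (max x₀ 0),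
      (hl.tendsto.const_mul_atTop (sub_pos.2 hcb)).eventually_ge_atTop C] with y h1 h2 h3 h4
    simp only [Function.comp] at h3
    have h3x := (le_max_left _ _).trans h3
    have h30 := (le_max_right _ _).trans h3
    have hfl := Nat.lt_floor_add_one (g (y + c * l y))
    have hle := Nat.floor_le (show 0 ≤ g (y + c * l y) by linarith)
    refine (hQ hle).trans ?_
    rw [hQR]
    refine Real.exp_le_exp.2 ?_
    have h7 : g (y + b * l y) ≤ ⌊g (y + c * l y)⌋₊ := by linarith
    have h5 := hR₀ (Set.mem_Ici.2 h3x) (Set.mem_Ici.2 (h3x.trans h7)) h7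
    have h6 := (abs_le.1 (hR₁ ⌊g (y + c * l y)⌋₊)).1
    linarith

theorem exp_neg_mul_log {y : ℝ} (hy : 0 < y) (a : ℝ) : Real.exp (-(a * Real.log y)) = y ^ (-a) := by
  rw [Real.rpow_def_of_pos hy]
  ring_nf

section Log

variable {Q g : ℝ → ℝ} {ε : ℝ}

theorem HasTail.eventually_exp_mul_le (h : HasTail Q g Real.log) (hε : 0 < ε) :
    ∀ᶠ y in atTop, Real.exp y * Q (g (y + (1 + ε) * Real.log y)) ≤ y ^ (-(1 + ε / 2)) := by
  filter_upwards [(h (1 + ε) (1 + ε / 2)).2 (by linarith), eventually_gt_atTop 0] with y hy hy0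
  rw [neg_add, Real.exp_add, exp_neg_mul_log hy0] at hy
  calc _ ≤ Real.exp y * (Real.exp (-y) * y ^ (-(1 + ε / 2))) := by gcongr
    _ = _ := by rw [← mul_assoc, ← Real.exp_add]; simp

theorem HasTail.eventually_le_exp_mul (h : HasTail Q g Real.log) (hε : 0 < ε) :
    ∀ᶠ y in atTop, y⁻¹ ≤ Real.exp y * Q (g (y + (1 - ε) * Real.log y)) := by
  filter_upwards [(h (1 - ε) 1).1 (by linarith), eventually_gt_atTop 0] with y hy hy0
  rw [neg_add, Real.exp_add, exp_neg_mul_log hy0, Real.rpow_neg_one] at hy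
  calc _ = Real.exp y * (Real.exp (-y) * y⁻¹) := by rw [← mul_assoc, ← Real.exp_add]; simp
    _ ≤ _ := by gcongr

theorem HasTail.eventually_log_le_exp_mul (h : HasTail Q g (fun y => Real.log (Real.log y)))
    (hε : 0 < ε) : ∀ᶠ y in atTop,
      2 * Real.log y ≤ Real.exp y * Q (g (y + (-1 - ε) * Real.log (Real.log y))) := by
  filter_upwards [(h (-1 - ε) (-1 - ε / 2)).1 (by linarith),
    Real.tendsto_log_atTop.eventually_gt_atTop 0,
    ((tendsto_rpow_atTop (half_pos hε)).comp Real.tendsto_log_atTop).eventually_ge_atTop 2]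
    with y hy hy0 hy2
  simp only [Function.comp] at hy2
  rw [neg_add, Real.exp_add, exp_neg_mul_log hy0] at hy
  calc 2 * Real.log y ≤ Real.log y ^ (ε / 2) * Real.log y := by gcongr
    _ = Real.log y ^ (-(-1 - ε / 2)) := by
      rw [show -(-1 - ε / 2) = ε / 2 + 1 by ring, Real.rpow_add_one hy0.ne']
    _ = Real.exp y * (Real.exp (-y) * Real.log y ^ (-(-1 - ε / 2))) := by
      rw [← mul_assoc, ← Real.exp_add]; simp
    _ ≤ _ := by gcongr

theorem HasTail.eventually_exp_mul_le_log (h : HasTail Q g (fun y => Real.log (Real.log y)))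
    (hε : 0 < ε) : ∀ᶠ y in atTop,
      Real.exp y * Q (g (y + (-1 + ε) * Real.log (Real.log y))) ≤ Real.log y / 8 := by
  filter_upwards [(h (-1 + ε) (-1 + ε / 2)).2 (by linarith),
    Real.tendsto_log_atTop.eventually_gt_atTop 0,
    ((tendsto_rpow_atTop (half_pos hε)).comp Real.tendsto_log_atTop).eventually_ge_atTop 8]
    with y hy hy0 hy2
  simp only [Function.comp] at hy2
  rw [neg_add, Real.exp_add, exp_neg_mul_log hy0] at hy
  calc _ ≤ Real.exp y * (Real.exp (-y) * Real.log y ^ (-(-1 + ε / 2))) := by gcongr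
    _ = Real.log y ^ (-(-1 + ε / 2)) := by rw [← mul_assoc, ← Real.exp_add]; simp
    _ = Real.log y / Real.log y ^ (ε / 2) := by
      rw [show -(-1 + ε / 2) = 1 - ε / 2 by ring, Real.rpow_sub hy0, Real.rpow_one]
    _ ≤ _ := by gcongr

end Log

/-! ### Borel–Cantelli lemmas for maxima of i.i.d. variables. -/

section BorelCantelli

variable {Ω : Type*} [MeasurableSpace Ω] {P : Measure Ω}

theorem ae_eventually_notMem_of_summable [IsProbabilityMeasure P] {s : ℕ → Set Ω} {a : ℕ → ℝ} (ha : Summable a)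
    (h : ∀ᶠ j in atTop, P.real (s j) ≤ a j) : ∀ᵐ ω ∂P, ∀ᶠ j in atTop, ω ∉ s j := by
  have hs : Summable (fun j => P.real (s j)) := by
    refine ha.of_norm_bounded_eventually_nat (h.mono fun j hj => ?_)
    rwa [Real.norm_of_nonneg measureReal_nonneg]
  refine ae_eventually_notMem ?_
  have h1 : ∀ j, P (s j) = ENNReal.ofReal (P.real (s j)) := fun j => by simp
  simp_rw [h1]
  exact hs.tsum_ofReal_ne_top

theorem ae_frequently_mem_of_not_summable [IsProbabilityMeasure P] {s : ℕ → Set Ω} (hm : ∀ j, MeasurableSet (s j))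
    (hs : iIndepSet s P) {a : ℕ → ℝ} (ha0 : ∀ j, 0 ≤ a j) (ha : ¬ Summable a)
    (h : ∀ᶠ j in atTop, a j ≤ P.real (s j)) : ∀ᵐ ω ∂P, ∃ᶠ j in atTop, ω ∈ s j := by
  have h1 : ∑' j, P (s j) = ⊤ := by
    by_contra hcon
    refine ha ((ENNReal.summable_toReal hcon).of_norm_bounded_eventually_nat ?_)
    filter_upwards [h] with j hj
    rwa [Real.norm_of_nonneg (ha0 j)]
  have h2 := measure_limsup_eq_one hm hs h1
  rw [← mem_ae_iff_prob_eq_one (MeasurableSet.measurableSet_limsup hm)] at h2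
  filter_upwards [h2] with ω hω
  exact mem_limsup_iff_frequently_mem.1 hω

variable {M : ℕ → Ω → EReal}

theorem iIndepSet_compl {s : ℕ → Set Ω} (hm : ∀ j, MeasurableSet (s j)) (hs : iIndepSet s P) :
    iIndepSet (fun j => (s j)ᶜ) P := by
  rw [iIndepSet_iff_meas_biInter fun j => (hm j).compl]
  exact fun t => (iIndepSet_iff s P).1 hs t fun j _ =>
    (MeasurableSpace.measurableSet_generateFrom (Set.mem_singleton _)).compl

theorem iIndepSet_block (hM : ∀ i, Measurable (M i)) (hind : iIndepFun M P) {I : ℕ → Finset ℕ}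
    (hI : Pairwise (Function.onFun Disjoint I)) (x : ℕ → ℝ) :
    iIndepSet (fun j => ⋂ i ∈ I j, M i ⁻¹' Set.Iic (x j : EReal)) P := by
  classical
  rw [iIndepSet_iff_meas_biInter fun j => Finset.measurableSet_biInter _ fun i _ =>
    hM i measurableSet_Iic]
  intro s
  -- By disjointness `i` lies in at most one block, so the threshold can be read as a function of
  -- `i` and independence of the `M i` applied once to the union of the blocks.
  have hb : ∀ i, ∃ j, ∀ k, i ∈ I k → k = j := by
    intro i
    by_cases h : ∃ j, i ∈ I j
    · obtain ⟨j, hj⟩ := h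
      refine ⟨j, fun k hk => ?_⟩
      by_contra hkj
      exact Finset.disjoint_left.1 (hI hkj) hk hj
    · exact ⟨0, fun k hk => absurd ⟨k, hk⟩ h⟩
  choose b hb using hb
  have h1 := hind.measure_inter_preimage_eq_mul (s.biUnion I)
    (sets := fun i => Set.Iic (x (b i) : EReal)) fun i _ => measurableSet_Iic
  rw [Finset.prod_biUnion fun j _ k _ hjk => hI hjk] at h1
  have h2 : ⋂ j ∈ s, ⋂ i ∈ I j, M i ⁻¹' Set.Iic (x j : EReal) =
      ⋂ i ∈ s.biUnion I, M i ⁻¹' Set.Iic (x (b i) : EReal) := by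
    rw [Finset.set_biInter_biUnion]
    exact Set.iInter₂_congr fun j _ => Set.iInter₂_congr fun i hi => by rw [← hb i j hi]
  rw [h2, h1]
  refine Finset.prod_congr rfl fun j _ => ?_
  rw [← hind.measure_inter_preimage_eq_mul (I j) fun i _ => measurableSet_Iic]
  congr 1
  exact Set.iInter₂_congr fun i hi => by rw [← hb i j hi]

variable [IsProbabilityMeasure P]

theorem measureReal_forall_le (hM : ∀ i, Measurable (M i)) (hind : iIndepFun M P)
    (hid : ∀ i, IdentDistrib (M i) (M 0) P P) (I : Finset ℕ) (x : ℝ) :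
    P.real (⋂ i ∈ I, M i ⁻¹' Set.Iic (x : EReal)) =
      (1 - P.real {ω | (x : EReal) < M 0 ω}) ^ I.card := by
  have h1 := hind.measure_inter_preimage_eq_mul I (sets := fun _ => Set.Iic (x : EReal))
    fun i _ => measurableSet_Iic
  rw [Finset.prod_congr rfl fun i _ => (hid i).measure_mem_eq measurableSet_Iic,
    Finset.prod_const] at h1
  rw [measureReal_def, h1, ENNReal.toReal_pow]
  congr 1
  rw [← probReal_compl_eq_one_sub (measurableSet_lt measurable_const (hM 0)), measureReal_def]
  congr 2
  ext ω
  simp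

theorem one_sub_pow_le_exp {q : ℝ} (hq : q ≤ 1) (n : ℕ) : (1 - q) ^ n ≤ Real.exp (-(n * q)) := by
  rw [show -(n * q) = n * -q by ring, Real.exp_nat_mul]
  exact pow_le_pow_left₀ (by linarith) (Real.one_sub_le_exp_neg q) n

/-- For `0 ≤ q ≤ 1/2` one has `(1 - q) * (1 + 2 * q) ≥ 1`, and `1 + 2 * q ≤ exp (2 * q)`. -/
theorem exp_le_one_sub_pow {q : ℝ} (hq0 : 0 ≤ q) (hq : q ≤ 1 / 2) (n : ℕ) :
    Real.exp (-(2 * (n * q))) ≤ (1 - q) ^ n := by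
  rw [show -(2 * (n * q)) = n * -(2 * q) by ring, Real.exp_nat_mul]
  refine pow_le_pow_left₀ (Real.exp_pos _).le ?_ n
  rw [Real.exp_neg]
  refine inv_le_of_inv_le₀ (by linarith) ?_
  refine le_trans ?_ (Real.add_one_le_exp _)
  rw [inv_le_iff_one_le_mul₀ (by linarith)]
  nlinarith

theorem ae_eventually_forall_le (hid : ∀ i, IdentDistrib (M i) (M 0) P P)
    {N : ℕ → ℕ} {x a : ℕ → ℝ} (ha : Summable a)
    (h : ∀ᶠ j in atTop, N j * P.real {ω | (x j : EReal) < M 0 ω} ≤ a j) :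
    ∀ᵐ ω ∂P, ∀ᶠ j in atTop, ∀ i < N j, M i ω ≤ x j := by
  have h1 := ae_eventually_notMem_of_summable (P := P)
    (s := fun j => ⋃ i ∈ Finset.range (N j), {ω | (x j : EReal) < M i ω}) ha ?_
  · filter_upwards [h1] with ω hω
    filter_upwards [hω] with j hj i hi
    simp only [Set.mem_iUnion, Finset.mem_range, not_exists] at hj
    exact not_lt.1 (hj i hi)
  · filter_upwards [h] with j hj
    refine (measureReal_biUnion_finset_le _ _).trans (le_trans (le_of_eq ?_) hj)
    rw [Finset.sum_congr rfl fun i _ => (show P.real {ω | (x j : EReal) < M i ω} =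
      P.real {ω | (x j : EReal) < M 0 ω} by
        rw [measureReal_def, measureReal_def]
        exact congrArg _ ((hid i).measure_mem_eq (s := Set.Ioi (x j : EReal)) measurableSet_Ioi))]
    simp

theorem ae_eventually_exists_lt (hM : ∀ i, Measurable (M i)) (hind : iIndepFun M P)
    (hid : ∀ i, IdentDistrib (M i) (M 0) P P) {N : ℕ → ℕ} {x a : ℕ → ℝ} (ha : Summable a)
    (h : ∀ᶠ j in atTop, Real.exp (-(N j * P.real {ω | (x j : EReal) < M 0 ω})) ≤ a j) :
    ∀ᵐ ω ∂P, ∀ᶠ j in atTop, ∃ i < N j, x j < M i ω := by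
  have h1 := ae_eventually_notMem_of_summable (P := P)
    (s := fun j => ⋂ i ∈ Finset.range (N j), M i ⁻¹' Set.Iic (x j : EReal)) ha ?_
  · filter_upwards [h1] with ω hω
    filter_upwards [hω] with j hj
    simpa using hj
  · filter_upwards [h] with j hj
    rw [measureReal_forall_le hM hind hid, Finset.card_range]
    exact (one_sub_pow_le_exp measureReal_le_one _).trans hj

theorem ae_frequently_exists_lt (hM : ∀ i, Measurable (M i)) (hind : iIndepFun M P)
    (hid : ∀ i, IdentDistrib (M i) (M 0) P P) {I : ℕ → Finset ℕ}
    (hI : Pairwise (Function.onFun Disjoint I)) {x a : ℕ → ℝ} (ha0 : ∀ j, 0 ≤ a j)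
    (ha : ¬ Summable a)
    (h : ∀ᶠ j in atTop,
      a j ≤ 1 - Real.exp (-((I j).card * P.real {ω | (x j : EReal) < M 0 ω}))) :
    ∀ᵐ ω ∂P, ∃ᶠ j in atTop, ∃ i ∈ I j, x j < M i ω := by
  have hm : ∀ j, MeasurableSet (⋂ i ∈ I j, M i ⁻¹' Set.Iic (x j : EReal)) := fun j =>
    Finset.measurableSet_biInter _ fun i _ => hM i measurableSet_Iic
  have h1 := ae_frequently_mem_of_not_summable (P := P) (fun j => (hm j).compl)
    (iIndepSet_compl hm (iIndepSet_block hM hind hI x)) ha0 ha ?_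
  · filter_upwards [h1] with ω hω
    refine hω.mono fun j hj => ?_
    simpa using hj
  · filter_upwards [h] with j hj
    rw [probReal_compl_eq_one_sub (hm j), measureReal_forall_le hM hind hid]
    have := one_sub_pow_le_exp (measureReal_le_one (μ := P) (s := {ω | (x j : EReal) < M 0 ω}))
      (I j).card
    linarith

theorem ae_frequently_forall_le (hM : ∀ i, Measurable (M i)) (hind : iIndepFun M P)
    (hid : ∀ i, IdentDistrib (M i) (M 0) P P) {I : ℕ → Finset ℕ}
    (hI : Pairwise (Function.onFun Disjoint I)) {x a : ℕ → ℝ} (ha0 : ∀ j, 0 ≤ a j)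
    (ha : ¬ Summable a) (hhalf : ∀ᶠ j in atTop, P.real {ω | (x j : EReal) < M 0 ω} ≤ 1 / 2)
    (h : ∀ᶠ j in atTop,
      a j ≤ Real.exp (-(2 * ((I j).card * P.real {ω | (x j : EReal) < M 0 ω})))) :
    ∀ᵐ ω ∂P, ∃ᶠ j in atTop, ∀ i ∈ I j, M i ω ≤ x j := by
  have hm : ∀ j, MeasurableSet (⋂ i ∈ I j, M i ⁻¹' Set.Iic (x j : EReal)) := fun j =>
    Finset.measurableSet_biInter _ fun i _ => hM i measurableSet_Iic
  have h1 := ae_frequently_mem_of_not_summable (P := P) hm (iIndepSet_block hM hind hI x) ha0 ha ?_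
  · filter_upwards [h1] with ω hω
    refine hω.mono fun j hj => ?_
    simpa using hj
  · filter_upwards [h, hhalf] with j hj hq
    rw [measureReal_forall_le hM hind hid]
    exact hj.trans (exp_le_one_sub_pow measureReal_nonneg hq _)

end BorelCantelli

/-! ### Almost sure bounds for maxima over `2 ^ j` cycles. -/

section Maxima

variable {Ω : Type*} [MeasurableSpace Ω] {P : Measure Ω} [IsProbabilityMeasure P]
  {M : ℕ → Ω → EReal} {g : ℝ → ℝ} {ε : ℝ}

theorem exp_natCast_mul_log_two (n : ℕ) : Real.exp (n * Real.log 2) = ((2 ^ n : ℕ) : ℝ) := by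
  rw [Real.exp_nat_mul, Real.exp_log two_pos]
  simp

theorem tendsto_natCast_mul_log_two :
    Tendsto (fun n : ℕ => (n : ℝ) * Real.log 2) atTop atTop :=
  tendsto_natCast_atTop_atTop.atTop_mul_const (Real.log_pos one_lt_two)

/-- The expected number of exceedances is at most a constant times `j ^ (-(1 + ε / 2))`, which is
summable; no independence is needed. -/
theorem ae_eventually_max_le (hid : ∀ i, IdentDistrib (M i) (M 0) P P)
    (hQ : HasTail (fun x => P.real {ω | (x : EReal) < M 0 ω}) g Real.log) (hε : 0 < ε) :
    ∀ᵐ ω ∂P, ∀ᶠ j : ℕ in atTop, ∀ i < 2 ^ j,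
      M i ω ≤ g (j * Real.log 2 + (1 + ε) * Real.log (j * Real.log 2)) := by
  have hs : Summable (fun j : ℕ => ((j : ℝ) * Real.log 2) ^ (-(1 + ε / 2))) := by
    simp_rw [Real.mul_rpow (Nat.cast_nonneg _) (Real.log_pos one_lt_two).le]
    exact (Real.summable_nat_rpow.2 (by linarith)).mul_right _
  refine ae_eventually_forall_le (N := fun j => 2 ^ j) hid hs ?_
  filter_upwards [tendsto_natCast_mul_log_two.eventually (hQ.eventually_exp_mul_le hε)] with j hj
  rwa [exp_natCast_mul_log_two] at hj

theorem ae_frequently_lt_max (hM : ∀ i, Measurable (M i)) (hind : iIndepFun M P)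
    (hid : ∀ i, IdentDistrib (M i) (M 0) P P)
    (hQ : HasTail (fun x => P.real {ω | (x : EReal) < M 0 ω}) g Real.log) (hε : 0 < ε) :
    ∀ᵐ ω ∂P, ∃ᶠ j : ℕ in atTop, ∃ i < 2 ^ j,
      g (j * Real.log 2 + (1 - ε) * Real.log (j * Real.log 2)) < M i ω := by
  have hl2 := Real.log_pos one_lt_two
  -- One factor `1/2` comes from keeping only the disjoint upper halves of the dyadic ranges, the
  -- other from `1 - exp (-u) ≥ u / 2` for small `u`.
  have hs : ¬ Summable (fun j : ℕ => ((j : ℝ) * Real.log 2)⁻¹ / 4) := by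
    intro h
    refine Real.not_summable_natCast_inv ((h.mul_right (4 * Real.log 2)).congr fun j => ?_)
    field_simp
  have hI : Pairwise (Function.onFun Disjoint fun j : ℕ => Finset.Ico (2 ^ (j - 1)) (2 ^ j)) := by
    intro j k hjk
    rw [Function.onFun, Finset.disjoint_left]
    intro i hi hi'
    rw [Finset.mem_Ico] at hi hi'
    have h1 := (Nat.pow_lt_pow_iff_right one_lt_two).1 (hi.1.trans_lt hi'.2)
    have h2 := (Nat.pow_lt_pow_iff_right one_lt_two).1 (hi'.1.trans_lt hi.2)
    omega
  have h1 := ae_frequently_exists_lt hM hind hid hI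
    (x := fun j : ℕ => g (j * Real.log 2 + (1 - ε) * Real.log (j * Real.log 2)))
    (fun j => by positivity) hs ?_
  · filter_upwards [h1] with ω hω
    refine hω.mono fun j hj => ?_
    obtain ⟨i, hi, h⟩ := hj
    exact ⟨i, (Finset.mem_Ico.1 hi).2, h⟩
  · filter_upwards [tendsto_natCast_mul_log_two.eventually (hQ.eventually_le_exp_mul hε),
      tendsto_natCast_mul_log_two.eventually_ge_atTop 1, eventually_ge_atTop 1] with j hj hj1 hj0
    rw [exp_natCast_mul_log_two] at hj
    have hcard : ((Finset.Ico (2 ^ (j - 1)) (2 ^ j)).card : ℝ) = ((2 ^ j : ℕ) : ℝ) / 2 := by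
      obtain ⟨m, rfl⟩ := Nat.exists_eq_add_of_le' hj0
      rw [Nat.card_Ico, Nat.add_sub_cancel, Nat.sub_eq_of_eq_add (show 2 ^ (m + 1) = 2 ^ m + 2 ^ m by rw [pow_succ, mul_two])]
      push_cast
      rw [pow_succ]
      ring
    rw [hcard]
    set y := (j : ℝ) * Real.log 2
    have hy1 : y⁻¹ ≤ 1 := inv_le_one_of_one_le₀ hj1
    have hy0 : 0 < y⁻¹ := by positivity
    have h2 : Real.exp (-(((2 ^ j : ℕ) : ℝ) / 2 *
        P.real {ω | (g (y + (1 - ε) * Real.log y) : EReal) < M 0 ω})) ≤ Real.exp (-(y⁻¹ / 2)) :=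
      Real.exp_le_exp.2 (by linarith)
    have h3 : Real.exp (-(y⁻¹ / 2)) ≤ 1 - y⁻¹ / 4 := by
      rw [Real.exp_neg]
      refine inv_le_of_inv_le₀ (by linarith) ?_
      refine le_trans ?_ (Real.add_one_le_exp _)
      rw [inv_le_iff_one_le_mul₀ (by linarith)]
      nlinarith
    linarith

/-- With `y = j * log 2`, the mean number of exceedances is at least `2 * log y`, so none occurs
with probability at most `y ^ (-2)`. -/
theorem ae_eventually_lt_max (hM : ∀ i, Measurable (M i)) (hind : iIndepFun M P)
    (hid : ∀ i, IdentDistrib (M i) (M 0) P P)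
    (hQ : HasTail (fun x => P.real {ω | (x : EReal) < M 0 ω}) g (fun y => Real.log (Real.log y)))
    (hε : 0 < ε) :
    ∀ᵐ ω ∂P, ∀ᶠ j : ℕ in atTop, ∃ i < 2 ^ j,
      g (j * Real.log 2 + (-1 - ε) * Real.log (Real.log (j * Real.log 2))) < M i ω := by
  have hs : Summable (fun j : ℕ => ((j : ℝ) * Real.log 2) ^ (-2 : ℝ)) := by
    simp_rw [Real.mul_rpow (Nat.cast_nonneg _) (Real.log_pos one_lt_two).le]
    exact (Real.summable_nat_rpow.2 (by norm_num)).mul_right _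
  refine ae_eventually_exists_lt (N := fun j => 2 ^ j) hM hind hid hs ?_
  filter_upwards [tendsto_natCast_mul_log_two.eventually (hQ.eventually_log_le_exp_mul hε),
    tendsto_natCast_mul_log_two.eventually_gt_atTop 0] with j hj hj0
  rw [exp_natCast_mul_log_two] at hj
  rw [← exp_neg_mul_log hj0]
  exact Real.exp_le_exp.2 (neg_le_neg hj)

/-- The events for nested ranges are dependent, so the sparse sizes `2 ^ j ^ 2` are used. All but a
fraction `2 ^ (-j)` of the cycles then lie in the newest block: the blocks are handled by
independence, and the earlier cycles by a union bound. -/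
theorem ae_frequently_max_le (hM : ∀ i, Measurable (M i)) (hind : iIndepFun M P)
    (hid : ∀ i, IdentDistrib (M i) (M 0) P P)
    (hQ : HasTail (fun x => P.real {ω | (x : EReal) < M 0 ω}) g (fun y => Real.log (Real.log y)))
    (hε : 0 < ε) :
    ∀ᵐ ω ∂P, ∃ᶠ j : ℕ in atTop, ∀ i < 2 ^ j,
      M i ω ≤ g (j * Real.log 2 + (-1 + ε) * Real.log (Real.log (j * Real.log 2))) := by
  have hl2 := Real.log_pos one_lt_two
  have hl21 : Real.log 2 ≤ 1 := by linarith [Real.log_two_lt_d9]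
  have hsq : Tendsto (fun j : ℕ => j ^ 2) atTop atTop := tendsto_pow_atTop two_ne_zero
  set x : ℕ → ℝ := fun j =>
    g (j * Real.log 2 + (-1 + ε) * Real.log (Real.log (j * Real.log 2))) with hx
  have hbound : ∀ᶠ j : ℕ in atTop, ((2 ^ j ^ 2 : ℕ) : ℝ) *
      P.real {ω | (x (j ^ 2) : EReal) < M 0 ω} ≤ Real.log j / 4 := by
    filter_upwards [hsq.eventually (tendsto_natCast_mul_log_two.eventually
      (hQ.eventually_exp_mul_le_log hε)), eventually_ge_atTop 1] with j hj hj1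
    rw [exp_natCast_mul_log_two] at hj
    have hj0 : (0 : ℝ) < j := by exact_mod_cast hj1
    refine hj.trans ?_
    have h1 : Real.log (((j ^ 2 : ℕ) : ℝ) * Real.log 2) ≤ 2 * Real.log j := by
      have h2 : Real.log ((j : ℝ) ^ 2) = 2 * Real.log j := by
        rw [Real.log_pow, Nat.cast_ofNat]
      rw [← h2, Nat.cast_pow]
      refine Real.log_le_log (by positivity) ?_
      exact mul_le_of_le_one_right (by positivity) hl21
    linarith
  have hI : Pairwise (Function.onFun Disjoint
      fun j : ℕ => Finset.Ico (2 ^ (j - 1) ^ 2) (2 ^ j ^ 2)) := by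
    intro j k hjk
    rw [Function.onFun, Finset.disjoint_left]
    intro i hi hi'
    rw [Finset.mem_Ico] at hi hi'
    have h1 := (Nat.pow_lt_pow_iff_right one_lt_two).1 (hi.1.trans_lt hi'.2)
    have h2 := (Nat.pow_lt_pow_iff_right one_lt_two).1 (hi'.1.trans_lt hi.2)
    have h3 := lt_of_pow_lt_pow_left₀ 2 (by omega) h1
    have h4 := lt_of_pow_lt_pow_left₀ 2 (by omega) h2
    omega
  have hlogle : ∀ᶠ j : ℕ in atTop, Real.log j ≤ j := Eventually.of_forall fun j =>
    Real.log_le_self (Nat.cast_nonneg _)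
  have hearly : ∀ᵐ ω ∂P, ∀ᶠ j : ℕ in atTop, ∀ i < 2 ^ (j - 1) ^ 2, M i ω ≤ x (j ^ 2) := by
    have hs : Summable (fun j : ℕ => (j : ℝ) ^ 1 * (1 / 2) ^ j) :=
      summable_pow_mul_geometric_of_norm_lt_one 1 (by norm_num)
    refine ae_eventually_forall_le (N := fun j => 2 ^ (j - 1) ^ 2) hid hs ?_
    filter_upwards [hbound, hlogle, eventually_ge_atTop 1] with j hj hjl hj1
    obtain ⟨m, rfl⟩ := Nat.exists_eq_add_of_le' hj1
    have h1 : ((2 ^ (m + 1 - 1) ^ 2 : ℕ) : ℝ) ≤ (1 / 2) ^ (m + 1) * ((2 ^ (m + 1) ^ 2 : ℕ) : ℝ) := by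
      rw [Nat.add_sub_cancel, one_div, inv_pow, inv_mul_eq_div, le_div_iff₀ (by positivity)]
      push_cast
      rw [← pow_add]
      exact pow_le_pow_right₀ one_le_two (by nlinarith)
    calc _ ≤ (1 / 2) ^ (m + 1) * ((2 ^ (m + 1) ^ 2 : ℕ) : ℝ) *
          P.real {ω | (x ((m + 1) ^ 2) : EReal) < M 0 ω} := by gcongr
      _ ≤ (1 / 2) ^ (m + 1) * (Real.log (m + 1 : ℕ) / 4) := by rw [mul_assoc]; gcongr
      _ ≤ (1 / 2) ^ (m + 1) * ((m + 1 : ℕ) : ℝ) := by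
        gcongr
        have : (0 : ℝ) ≤ ((m + 1 : ℕ) : ℝ) := Nat.cast_nonneg _
        linarith
      _ = _ := by ring
  -- The mean number of exceedances in block `j` is at most `log j / 4`; `exp_le_one_sub_pow`
  -- doubles it, giving probability at least `j ^ (-1/2)`.
  have hs : ¬ Summable (fun j : ℕ => (j : ℝ) ^ (-(1 / 2) : ℝ)) := by
    rw [Real.summable_nat_rpow]
    norm_num
  have hblock := ae_frequently_forall_le hM hind hid hI (x := fun j => x (j ^ 2))
    (fun j => by positivity) hs ?_ ?_
  · filter_upwards [hearly, hblock] with ω h1 h2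
    have h3 : ∃ᶠ j : ℕ in atTop, ∀ i < 2 ^ j ^ 2, M i ω ≤ x (j ^ 2) := by
      refine (h2.and_eventually h1).mono fun j hj i hi => ?_
      rcases lt_or_ge i (2 ^ (j - 1) ^ 2) with h | h
      · exact hj.2 i h
      · exact hj.1 i (Finset.mem_Ico.2 ⟨h, hi⟩)
    exact hsq.frequently h3
  · filter_upwards [hbound, hlogle, eventually_ge_atTop 1] with j hj hjl hj1
    have hj0 : (1 : ℝ) ≤ j := by exact_mod_cast hj1
    have h1 : (j : ℝ) ≤ ((2 ^ j ^ 2 : ℕ) : ℝ) := by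
      exact_mod_cast (Nat.lt_two_pow_self (n := j)).le.trans
        (Nat.pow_le_pow_right two_pos (Nat.le_self_pow two_ne_zero j))
    have h2 : (j : ℝ) * P.real {ω | (x (j ^ 2) : EReal) < M 0 ω} ≤ j * (1 / 2) :=
      calc _ ≤ ((2 ^ j ^ 2 : ℕ) : ℝ) * P.real {ω | (x (j ^ 2) : EReal) < M 0 ω} := by gcongr
        _ ≤ _ := by linarith
    exact le_of_mul_le_mul_left h2 (by linarith)
  · filter_upwards [hbound, eventually_ge_atTop 1] with j hj hj1
    have hj0 : (0 : ℝ) < j := by exact_mod_cast hj1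
    rw [← exp_neg_mul_log hj0]
    refine Real.exp_le_exp.2 (neg_le_neg ?_)
    have h1 : ((Finset.Ico (2 ^ (j - 1) ^ 2) (2 ^ j ^ 2)).card : ℝ) ≤ ((2 ^ j ^ 2 : ℕ) : ℝ) := by
      rw [Nat.card_Ico]
      exact_mod_cast Nat.sub_le _ _
    have h2 : ((Finset.Ico (2 ^ (j - 1) ^ 2) (2 ^ j ^ 2)).card : ℝ) *
        P.real {ω | (x (j ^ 2) : EReal) < M 0 ω} ≤ ((2 ^ j ^ 2 : ℕ) : ℝ) *
        P.real {ω | (x (j ^ 2) : EReal) < M 0 ω} := by gcongr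
    linarith

end Maxima

/-! ### From cycle maxima to the running supremum of a path. -/

section Path

variable {Ω : Type*} {c : ℕ → Ω → RegenCycle} {ω : Ω} {x : ℝ≥0 → ℝ}

theorem epoch_succ (k : ℕ) : epoch c (k + 1) ω = epoch c k ω + (c k ω).duration :=
  Finset.sum_range_succ _ _

theorem epoch_mono : Monotone fun k => epoch c k ω :=
  monotone_nat_of_le_succ fun k => by simp [epoch_succ]

theorem exists_epoch_le_lt {n : ℕ} {s : ℝ≥0} (hs : s < epoch c n ω) :
    ∃ k < n, epoch c k ω ≤ s ∧ s < epoch c (k + 1) ω := by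
  induction n with
  | zero => simp [epoch] at hs
  | succ n ih =>
    rcases lt_or_ge s (epoch c n ω) with h | h
    · obtain ⟨k, hk, h'⟩ := ih h
      exact ⟨k, hk.trans n.lt_succ_self, h'⟩
    · exact ⟨n, n.lt_succ_self, h, hs⟩

theorem runningSup_le_of_le_epoch
    (hx : ∀ (k : ℕ) (t : ℝ≥0), epoch c k ω ≤ t → t < epoch c (k + 1) ω →
      x t = (c k ω).path (t - epoch c k ω)) {n : ℕ} {t : ℝ≥0} (ht : t ≤ epoch c n ω) {b : EReal}
    (hb : ∀ i < n, runningSup (c i ω).path (c i ω).duration ≤ b) : runningSup x t ≤ b := by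
  refine iSup₂_le fun s hs => ?_
  obtain ⟨k, hk, h1, h2⟩ := exists_epoch_le_lt (hs.trans_le ht)
  rw [hx k s h1 h2]
  refine le_trans ?_ (hb k hk)
  refine le_iSup₂ (f := fun (s : ℝ≥0) (_ : s < (c k ω).duration) => ((c k ω).path s : EReal))
    (s - epoch c k ω) ?_
  rw [epoch_succ] at h2
  exact (tsub_lt_iff_left h1).2 h2

theorem le_runningSup_of_epoch_le
    (hx : ∀ (k : ℕ) (t : ℝ≥0), epoch c k ω ≤ t → t < epoch c (k + 1) ω →
      x t = (c k ω).path (t - epoch c k ω)) {n i : ℕ} {t : ℝ≥0} (ht : epoch c n ω ≤ t)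
    (hi : i < n) : runningSup (c i ω).path (c i ω).duration ≤ runningSup x t := by
  refine iSup₂_le fun s hs => ?_
  have h1 : epoch c i ω + s < epoch c (i + 1) ω := by
    rw [epoch_succ]
    exact (add_lt_add_iff_left _).2 hs
  have h2 : epoch c i ω + s < t := h1.trans_le ((epoch_mono hi).trans ht)
  have h3 := hx i _ le_self_add h1
  rw [add_tsub_cancel_left] at h3
  rw [← h3]
  exact le_iSup₂ (f := fun (s : ℝ≥0) (_ : s < t) => (x s : EReal)) _ h2

theorem runningSup_duration_zero
    (hx : ∀ (k : ℕ) (t : ℝ≥0), epoch c k ω ≤ t → t < epoch c (k + 1) ω →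
      x t = (c k ω).path (t - epoch c k ω)) :
    runningSup x (c 0 ω).duration = runningSup (c 0 ω).path (c 0 ω).duration := by
  have h1 : epoch c 1 ω = (c 0 ω).duration := by simp [epoch]
  refine le_antisymm (runningSup_le_of_le_epoch hx h1.ge fun i hi => ?_)
    (le_runningSup_of_epoch_le hx h1.le one_pos)
  rw [Nat.lt_one_iff.1 hi]

end Path

section Near

variable {g h l : ℝ → ℝ}

/-- Moving from `y` to `z` changes `y + a * l y` by at most `K + |a|`, less than `(b - a) * l y`
eventually. This lets `log (t / α)` and `j * log 2` be interchanged. -/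
theorem SlowGrowth.eventually_near_le (hg : SlowGrowth g h l) (hl : IsScale l) {a b : ℝ}
    (hab : a < b) (K : ℝ) :
    ∀ᶠ y in atTop, ∀ z, |z - y| ≤ K → g (z + a * l z) ≤ g (y + b * l y) := by
  obtain ⟨Y, hY⟩ := hg.exists_strictMonoOn
  filter_upwards [hl.eventually_near K,
    (hl.tendsto_add_mul a).eventually_ge_atTop (Y + K + |a|),
    (hl.tendsto.const_mul_atTop (sub_pos.2 hab)).eventually_ge_atTop (K + |a|)] with y h1 h2 h3 z hz
  have h4 : |a * (l z - l y)| ≤ |a| := by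
    rw [abs_mul]
    exact mul_le_of_le_one_right (abs_nonneg a) (h1 z hz)
  rw [abs_le] at h4 hz
  exact hY.monotoneOn (Set.mem_Ici.2 (by linarith)) (Set.mem_Ici.2 (by linarith)) (by linarith)

theorem SlowGrowth.eventually_le_near (hg : SlowGrowth g h l) (hl : IsScale l) {a b : ℝ}
    (hab : b < a) (K : ℝ) :
    ∀ᶠ y in atTop, ∀ z, |z - y| ≤ K → g (y + b * l y) ≤ g (z + a * l z) := by
  obtain ⟨Y, hY⟩ := hg.exists_strictMonoOn
  filter_upwards [hl.eventually_near K,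
    (hl.tendsto_add_mul b).eventually_ge_atTop Y,
    (hl.tendsto.const_mul_atTop (sub_pos.2 hab)).eventually_ge_atTop (K + |a|)] with y h1 h2 h3 z hz
  have h4 : |a * (l z - l y)| ≤ |a| := by
    rw [abs_mul]
    exact mul_le_of_le_one_right (abs_nonneg a) (h1 z hz)
  rw [abs_le] at h4 hz
  exact hY.monotoneOn (Set.mem_Ici.2 (by linarith)) (Set.mem_Ici.2 (by linarith)) (by linarith)

end Near

theorem tendsto_log_div_atTop {α : ℝ} (hα : 0 < α) :
    Tendsto (fun t : ℝ≥0 => Real.log (t / α)) atTop atTop :=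
  Real.tendsto_log_atTop.comp (NNReal.tendsto_coe_atTop.2 tendsto_id |>.atTop_div_const hα)

theorem abs_log_sub_log_le_two {a b : ℝ} (ha : 0 < a) (hb : 0 < b) (h1 : a ≤ 4 * b)
    (h2 : b ≤ 4 * a) : |Real.log a - Real.log b| ≤ 2 := by
  have h3 := Real.log_le_log ha h1
  have h4 := Real.log_le_log hb h2
  have h5 : Real.log 4 ≤ 2 := by
    rw [show (4 : ℝ) = 2 ^ 2 by norm_num, Real.log_pow]
    have := Real.log_two_lt_d9
    push_cast
    linarith
  rw [Real.log_mul four_ne_zero hb.ne'] at h3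
  rw [Real.log_mul four_ne_zero ha.ne'] at h4
  rw [abs_le]
  constructor <;> linarith

theorem natCast_mul_log_two_eq (j : ℕ) : (j : ℝ) * Real.log 2 = Real.log (2 ^ j) := by
  rw [Real.log_pow]

theorem tendsto_two_pow_atTop : Tendsto (fun j : ℕ => 2 ^ j) atTop atTop :=
  tendsto_pow_atTop_atTop_of_one_lt one_lt_two

section Transfer

variable {Ω : Type*} {c : ℕ → Ω → RegenCycle} {ω : Ω} {x : ℝ≥0 → ℝ} {g h l : ℝ → ℝ} {α a b : ℝ}

theorem eventually_runningSup_le (hg : SlowGrowth g h l) (hl : IsScale l) (hα : 0 < α)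
    (hx : ∀ (k : ℕ) (t : ℝ≥0), epoch c k ω ≤ t → t < epoch c (k + 1) ω →
      x t = (c k ω).path (t - epoch c k ω))
    (hS : ∀ᶠ n : ℕ in atTop, α * n / 2 ≤ epoch c n ω) (hab : a < b)
    (hM : ∀ᶠ j : ℕ in atTop, ∀ i < 2 ^ j, runningSup (c i ω).path (c i ω).duration ≤
      g (j * Real.log 2 + a * l (j * Real.log 2))) :
    ∀ᶠ t : ℝ≥0 in atTop,
      runningSup x t ≤ g (Real.log (t / α) + b * l (Real.log (t / α))) := by
  obtain ⟨J, hJ⟩ := eventually_atTop.1 (hM.and (tendsto_two_pow_atTop.eventually hS))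
  have ht : Tendsto (fun t : ℝ≥0 => (t : ℝ)) atTop atTop := NNReal.tendsto_coe_atTop.2 tendsto_id
  filter_upwards [(tendsto_log_div_atTop hα).eventually (hg.eventually_near_le hl hab 2),
    (ht.atTop_div_const hα).eventually_ge_atTop (2 ^ J)] with t hnear htJ
  have h1J : (1 : ℝ) ≤ 2 ^ J := one_le_pow₀ one_le_two
  -- Then `α * 2 ^ (m + 1) / 2 > t`, so `2 ^ (m + 1)` cycles cover `[0, t)`.
  obtain ⟨m, hm1, hm2⟩ := exists_nat_pow_near (show 1 ≤ 2 * ((t : ℝ) / α) by linarith) one_lt_two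
  have hJm : J ≤ m + 1 := (pow_le_pow_iff_right₀ (one_lt_two (α := ℝ))).1 (by linarith)
  obtain ⟨h1, h2⟩ := hJ (m + 1) hJm
  have h3 : t ≤ epoch c (2 ^ (m + 1)) ω := by
    rw [← NNReal.coe_le_coe]
    refine le_trans ?_ h2
    push_cast
    have := mul_le_mul_of_nonneg_left hm2.le hα.le
    rw [show α * (2 * ((t : ℝ) / α)) = 2 * t by field_simp] at this
    linarith
  refine (runningSup_le_of_le_epoch hx h3 h1).trans (EReal.coe_le_coe_iff.2 (hnear _ ?_))
  rw [natCast_mul_log_two_eq]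
  refine abs_log_sub_log_le_two (by positivity) (by linarith) ?_ (by linarith)
  rw [pow_succ]
  linarith

theorem eventually_le_runningSup (hg : SlowGrowth g h l) (hl : IsScale l) (hα : 0 < α)
    (hx : ∀ (k : ℕ) (t : ℝ≥0), epoch c k ω ≤ t → t < epoch c (k + 1) ω →
      x t = (c k ω).path (t - epoch c k ω))
    (hS : ∀ᶠ n : ℕ in atTop, epoch c n ω ≤ 2 * α * n) (hab : b < a)
    (hM : ∀ᶠ j : ℕ in atTop, ∃ i < 2 ^ j, g (j * Real.log 2 + a * l (j * Real.log 2)) <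
      runningSup (c i ω).path (c i ω).duration) :
    ∀ᶠ t : ℝ≥0 in atTop,
      g (Real.log (t / α) + b * l (Real.log (t / α))) ≤ runningSup x t := by
  obtain ⟨J, hJ⟩ := eventually_atTop.1 (hM.and (tendsto_two_pow_atTop.eventually hS))
  have ht : Tendsto (fun t : ℝ≥0 => (t : ℝ)) atTop atTop := NNReal.tendsto_coe_atTop.2 tendsto_id
  filter_upwards [(tendsto_log_div_atTop hα).eventually (hg.eventually_le_near hl hab 2),
    (ht.atTop_div_const hα).eventually_ge_atTop (2 ^ (J + 1))] with t hnear htJ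
  have h1J : (1 : ℝ) ≤ 2 ^ J := one_le_pow₀ one_le_two
  rw [pow_succ] at htJ
  -- Then `2 * α * 2 ^ m ≤ t`, so `2 ^ m` cycles are complete by time `t`.
  obtain ⟨m, hm1, hm2⟩ := exists_nat_pow_near (show 1 ≤ (t : ℝ) / α / 2 by linarith) one_lt_two
  have hJm : J < m + 1 := (pow_lt_pow_iff_right₀ (one_lt_two (α := ℝ))).1 (by linarith)
  obtain ⟨⟨i, hi, h1⟩, h2⟩ := hJ m (Nat.lt_succ_iff.1 hJm)
  have h3 : epoch c (2 ^ m) ω ≤ t := by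
    rw [← NNReal.coe_le_coe]
    refine h2.trans ?_
    push_cast
    have := mul_le_mul_of_nonneg_left hm1 hα.le
    rw [show α * ((t : ℝ) / α / 2) = t / 2 by field_simp] at this
    linarith
  refine le_trans (EReal.coe_le_coe_iff.2 (hnear _ ?_))
    (h1.le.trans (le_runningSup_of_epoch_le hx h3 hi))
  rw [natCast_mul_log_two_eq]
  rw [pow_succ] at hm2
  exact abs_log_sub_log_le_two (by positivity) (by linarith) (by linarith) (by linarith)

theorem frequently_le_runningSup (hg : SlowGrowth g h l) (hl : IsScale l) (hα : 0 < α)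
    (hx : ∀ (k : ℕ) (t : ℝ≥0), epoch c k ω ≤ t → t < epoch c (k + 1) ω →
      x t = (c k ω).path (t - epoch c k ω))
    (hS : ∀ᶠ n : ℕ in atTop, epoch c n ω ≤ 2 * α * n) (hab : b < a)
    (hM : ∃ᶠ j : ℕ in atTop, ∃ i < 2 ^ j, g (j * Real.log 2 + a * l (j * Real.log 2)) <
      runningSup (c i ω).path (c i ω).duration) :
    ∃ᶠ t : ℝ≥0 in atTop,
      g (Real.log (t / α) + b * l (Real.log (t / α))) ≤ runningSup x t := by
  have hα' : 0 < 2 * α.toNNReal := by simpa using hα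
  have ht : Tendsto (fun j : ℕ => 2 * α.toNNReal * 2 ^ j) atTop atTop :=
    (tendsto_pow_atTop_atTop_of_one_lt one_lt_two).const_mul_atTop hα'
  refine ht.frequently ((hM.and_eventually ((tendsto_two_pow_atTop.eventually hS).and
    (((tendsto_log_div_atTop hα).comp ht).eventually (hg.eventually_le_near hl hab 2)))).mono ?_)
  rintro j ⟨⟨i, hi, h1⟩, h2, hnear⟩
  have hcoe : ((2 * α.toNNReal * 2 ^ j : ℝ≥0) : ℝ) = 2 * α * 2 ^ j := by
    push_cast
    rw [Real.coe_toNNReal _ hα.le]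
  have h3 : epoch c (2 ^ j) ω ≤ 2 * α.toNNReal * 2 ^ j := by
    rw [← NNReal.coe_le_coe, hcoe]
    exact_mod_cast h2
  refine le_trans (EReal.coe_le_coe_iff.2 (hnear _ ?_))
    (h1.le.trans (le_runningSup_of_epoch_le hx h3 hi))
  simp only [Function.comp]
  rw [natCast_mul_log_two_eq, hcoe, show 2 * α * 2 ^ j / α = 2 * 2 ^ j by field_simp]
  have : (0 : ℝ) < 2 ^ j := by positivity
  exact abs_log_sub_log_le_two (by positivity) (by linarith) (by linarith) (by linarith)

theorem frequently_runningSup_le (hg : SlowGrowth g h l) (hl : IsScale l) (hα : 0 < α)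
    (hx : ∀ (k : ℕ) (t : ℝ≥0), epoch c k ω ≤ t → t < epoch c (k + 1) ω →
      x t = (c k ω).path (t - epoch c k ω))
    (hS : ∀ᶠ n : ℕ in atTop, α * n / 2 ≤ epoch c n ω) (hab : a < b)
    (hM : ∃ᶠ j : ℕ in atTop, ∀ i < 2 ^ j, runningSup (c i ω).path (c i ω).duration ≤
      g (j * Real.log 2 + a * l (j * Real.log 2))) :
    ∃ᶠ t : ℝ≥0 in atTop,
      runningSup x t ≤ g (Real.log (t / α) + b * l (Real.log (t / α))) := by
  have hα' : 0 < α.toNNReal / 2 := by simpa using hα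
  have ht : Tendsto (fun j : ℕ => α.toNNReal / 2 * 2 ^ j) atTop atTop :=
    (tendsto_pow_atTop_atTop_of_one_lt one_lt_two).const_mul_atTop hα'
  refine ht.frequently ((hM.and_eventually ((tendsto_two_pow_atTop.eventually hS).and
    (((tendsto_log_div_atTop hα).comp ht).eventually (hg.eventually_near_le hl hab 2)))).mono ?_)
  rintro j ⟨h1, h2, hnear⟩
  have hcoe : ((α.toNNReal / 2 * 2 ^ j : ℝ≥0) : ℝ) = α / 2 * 2 ^ j := by
    push_cast
    rw [Real.coe_toNNReal _ hα.le]
  have h3 : α.toNNReal / 2 * 2 ^ j ≤ epoch c (2 ^ j) ω := by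
    rw [← NNReal.coe_le_coe, hcoe]
    push_cast at h2
    linarith
  refine (runningSup_le_of_le_epoch hx h3 h1).trans (EReal.coe_le_coe_iff.2 (hnear _ ?_))
  simp only [Function.comp]
  rw [natCast_mul_log_two_eq, hcoe, show α / 2 * 2 ^ j / α = 2 ^ j / 2 by field_simp]
  have : (0 : ℝ) < 2 ^ j := by positivity
  exact abs_log_sub_log_le_two (by positivity) (by linarith) (by linarith) (by linarith)

end Transfer

/-! ### Normalization, and limits from threshold bounds. -/

section Normalized

variable {R₀ L : ℝ → ℝ} {α : ℝ}

theorem normalizedSup_le {x : ℝ≥0 → ℝ} {t : ℝ≥0} {b : ℝ}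
    (hr : 0 ≤ deriv R₀ (centering R₀ α t)) (hL : 0 ≤ L t) (h : runningSup x t ≤ b) :
    normalizedSup R₀ α L x t ≤
      ((deriv R₀ (centering R₀ α t) * (b - centering R₀ α t) / L t : ℝ) : EReal) := by
  rw [EReal.coe_div, EReal.coe_mul, EReal.coe_sub]
  refine EReal.div_le_div_right_of_nonneg (EReal.coe_nonneg.2 hL) ?_
  exact mul_le_mul_of_nonneg_left (EReal.sub_le_sub h le_rfl) (EReal.coe_nonneg.2 hr)

theorem le_normalizedSup {x : ℝ≥0 → ℝ} {t : ℝ≥0} {b : ℝ}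
    (hr : 0 ≤ deriv R₀ (centering R₀ α t)) (hL : 0 ≤ L t) (h : b ≤ runningSup x t) :
    ((deriv R₀ (centering R₀ α t) * (b - centering R₀ α t) / L t : ℝ) : EReal) ≤
      normalizedSup R₀ α L x t := by
  rw [EReal.coe_div, EReal.coe_mul, EReal.coe_sub]
  refine EReal.div_le_div_right_of_nonneg (EReal.coe_nonneg.2 hL) ?_
  exact mul_le_mul_of_nonneg_left (EReal.sub_le_sub h le_rfl) (EReal.coe_nonneg.2 hr)

/-- This is `tendsto_increment` at `y = log (t / α)`, where `1 / h y` is the derivative of `R₀` at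
the centering; replacing `l (log (t / α))` by `l (log t)` is harmless because they differ by at most
`1` eventually. -/
theorem tendsto_normalized {l : ℝ → ℝ}
    (hg : SlowGrowth (genInv R₀) (fun y => 1 / deriv R₀ (genInv R₀ y)) l) (hl : IsScale l)
    (hα : 0 < α) (hL : ∀ t, L t = l (Real.log t)) (a : ℝ) :
    Tendsto (fun t : ℝ≥0 => deriv R₀ (centering R₀ α t) *
      (genInv R₀ (Real.log (t / α) + a * l (Real.log (t / α))) - centering R₀ α t) / L t)
      atTop (𝓝 a) := by
  have hy := tendsto_log_div_atTop hα
  have h1 := (hg.tendsto_increment hl a).comp hy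
  have hlog : Tendsto (fun t : ℝ≥0 => Real.log t) atTop atTop :=
    Real.tendsto_log_atTop.comp (NNReal.tendsto_coe_atTop.2 tendsto_id)
  have h2 : Tendsto (fun t : ℝ≥0 => l (Real.log (t / α)) / l (Real.log t)) atTop (𝓝 1) := by
    rw [tendsto_iff_norm_sub_tendsto_zero]
    have h3 : Tendsto (fun t : ℝ≥0 => (l (Real.log t))⁻¹) atTop (𝓝 0) :=
      tendsto_inv_atTop_zero.comp (hl.tendsto.comp hlog)
    refine squeeze_zero' (Eventually.of_forall fun _ => norm_nonneg _) ?_ h3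
    filter_upwards [hlog.eventually (hl.eventually_near |Real.log α|),
      (hl.tendsto.comp hlog).eventually_gt_atTop 0, eventually_gt_atTop 0] with t ht ht0 htpos
    simp only [Function.comp] at ht0
    have h4 := ht (Real.log (t / α)) (by
      rw [Real.log_div (by exact_mod_cast htpos.ne') hα.ne', sub_sub_cancel_left, abs_neg])
    rw [div_sub_one ht0.ne', Real.norm_eq_abs, abs_div, abs_of_pos ht0, inv_eq_one_div]
    gcongr
  have h3 := h1.mul h2
  rw [mul_one] at h3
  refine h3.congr' ?_
  filter_upwards [hy.eventually hg.pos, (hl.tendsto.comp hy).eventually_gt_atTop 0] with t ht ht0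
  have hr : 0 < deriv R₀ (genInv R₀ (Real.log (t / α))) := one_div_pos.1 ht
  simp only [Function.comp] at ht0
  simp only [Function.comp, hL, centering]
  field_simp

end Normalized

section Limits

variable {u : ℝ≥0 → EReal} {φ : ℝ → ℝ≥0 → ℝ} {a : ℝ}

theorem limsup_eq_of_bounds (hφ : ∀ b, Tendsto (φ b) atTop (𝓝 b))
    (h1 : ∀ b > a, ∀ᶠ t in atTop, u t ≤ φ b t) (h2 : ∀ b < a, ∃ᶠ t in atTop, (φ b t : EReal) ≤ u t) :
    limsup u atTop = a := by
  apply le_antisymm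
  · refine EReal.le_of_forall_lt_iff_le.1 fun b hb => ?_
    obtain ⟨b', hb1, hb2⟩ := exists_between (EReal.coe_lt_coe_iff.1 hb)
    refine limsup_le_of_le (by isBoundedDefault) ?_
    filter_upwards [h1 b' hb1, (hφ b').eventually_lt_const hb2] with t ht ht'
    exact ht.trans (EReal.coe_le_coe_iff.2 ht'.le)
  · refine EReal.ge_of_forall_gt_iff_ge.1 fun b hb => ?_
    obtain ⟨b', hb1, hb2⟩ := exists_between (EReal.coe_lt_coe_iff.1 hb)
    refine le_limsup_of_frequently_le ?_ (by isBoundedDefault)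
    refine ((h2 b' hb2).and_eventually ((hφ b').eventually_const_lt hb1)).mono fun t ht => ?_
    exact (EReal.coe_le_coe_iff.2 ht.2.le).trans ht.1

theorem liminf_eq_of_bounds (hφ : ∀ b, Tendsto (φ b) atTop (𝓝 b))
    (h1 : ∀ b < a, ∀ᶠ t in atTop, (φ b t : EReal) ≤ u t) (h2 : ∀ b > a, ∃ᶠ t in atTop, u t ≤ φ b t) :
    liminf u atTop = a := by
  apply le_antisymm
  · refine EReal.le_of_forall_lt_iff_le.1 fun b hb => ?_
    obtain ⟨b', hb1, hb2⟩ := exists_between (EReal.coe_lt_coe_iff.1 hb)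
    refine liminf_le_of_frequently_le ?_ (by isBoundedDefault)
    refine ((h2 b' hb1).and_eventually ((hφ b').eventually_lt_const hb2)).mono fun t ht => ?_
    exact ht.1.trans (EReal.coe_le_coe_iff.2 ht.2.le)
  · refine EReal.ge_of_forall_gt_iff_ge.1 fun b hb => ?_
    obtain ⟨b', hb1, hb2⟩ := exists_between (EReal.coe_lt_coe_iff.1 hb)
    refine le_liminf_of_le (by isBoundedDefault) ?_
    filter_upwards [h1 b' hb2, (hφ b').eventually_const_lt hb1] with t ht ht'
    exact (EReal.coe_le_coe_iff.2 ht'.le).trans ht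

end Limits

/-! ### Probabilistic input from the regenerative structure. -/

theorem RegenCycle.measurable_duration : Measurable RegenCycle.duration :=
  measurable_iff_comap_le.2 (le_sup_left.trans le_sup_left)

theorem RegenCycle.measurable_runningSup :
    Measurable fun c : RegenCycle => runningSup c.path c.duration :=
  measurable_iff_comap_le.2 le_sup_right

namespace IsRegenerative

variable {Ω : Type*} [MeasurableSpace Ω] {P : Measure Ω} {X : ℝ≥0 → Ω → ℝ}
  {c : ℕ → Ω → RegenCycle}

/-- Identical distribution gives only a.e. measurable cycles, so measurable versions of the maxima
are chosen for the Borel–Cantelli arguments. -/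
theorem exists_cycleMax (hX : IsRegenerative P X c) :
    ∃ M : ℕ → Ω → EReal, (∀ i, Measurable (M i)) ∧ iIndepFun M P ∧
      (∀ i, IdentDistrib (M i) (M 0) P P) ∧
      ∀ᵐ ω ∂P, ∀ i, M i ω = runningSup (c i ω).path (c i ω).duration := by
  have hid := fun i => (hX.identDistrib i).comp RegenCycle.measurable_runningSup
  have hind := hX.indep.comp (fun _ cyc => runningSup cyc.path cyc.duration)
    fun _ => RegenCycle.measurable_runningSup
  have hm := fun i => (hid i).aemeasurable_fst
  refine ⟨fun i => (hm i).mk, fun i => (hm i).measurable_mk,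
    hind.congr fun i => (hm i).ae_eq_mk, fun i => ?_, ae_all_iff.2 fun i => (hm i).ae_eq_mk.symm⟩
  exact ((IdentDistrib.of_ae_eq (hm i) (hm i).ae_eq_mk).symm.trans (hid i)).trans
    (IdentDistrib.of_ae_eq (hm 0) (hm 0).ae_eq_mk)

theorem tailExponent_eq (hX : IsRegenerative P X c) {M : Ω → EReal}
    (hM : ∀ᵐ ω ∂P, M ω = runningSup (c 0 ω).path (c 0 ω).duration) (k : ℕ) :
    tailExponent P X c k = -Real.log (P.real {ω | (((k : ℝ) : ℝ) : EReal) < M ω}) := by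
  rw [tailExponent]
  congr 2
  refine measureReal_congr ?_
  filter_upwards [hX.eq_cycle, hM] with ω h1 h2
  refine propext ?_
  change _ < _ ↔ _ < _
  rw [runningSup_duration_zero h1, h2]

theorem tendsto_epoch_div (hX : IsRegenerative P X c)
    (hT : Integrable (fun ω => ((c 0 ω).duration : ℝ)) P) :
    ∀ᵐ ω ∂P, Tendsto (fun n : ℕ => (epoch c n ω : ℝ) / n) atTop (𝓝 (meanDuration P c)) := by
  have hm : Measurable fun cyc : RegenCycle => (cyc.duration : ℝ) :=
    measurable_coe_nnreal_real.comp RegenCycle.measurable_duration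
  have h := strong_law_ae_real (fun i ω => ((c i ω).duration : ℝ)) hT
    (fun i j hij => (hX.indep.indepFun hij).comp hm hm) fun i => (hX.identDistrib i).comp hm
  filter_upwards [h] with ω hω
  simpa [epoch, meanDuration] using hω

/-- If the mean were `0`, almost every first cycle would be empty, with supremum `⊥`, and could
exceed nothing. -/
theorem meanDuration_pos (hT : Integrable (fun ω => ((c 0 ω).duration : ℝ)) P) {M : Ω → EReal}
    (hM : ∀ᵐ ω ∂P, M ω = runningSup (c 0 ω).path (c 0 ω).duration) {x : ℝ}
    (hx : 0 < P.real {ω | (x : EReal) < M ω}) : 0 < meanDuration P c := by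
  refine lt_of_le_of_ne (integral_nonneg fun _ => NNReal.coe_nonneg _) fun h => hx.ne' ?_
  have h1 := (integral_eq_zero_iff_of_nonneg (fun _ => NNReal.coe_nonneg _) hT).1 h.symm
  rw [measureReal_def, measure_eq_zero_iff_ae_notMem.2, ENNReal.toReal_zero]
  filter_upwards [h1, hM] with ω h2 h3
  have h4 : (c 0 ω).duration = 0 := NNReal.coe_eq_zero.1 h2
  change ¬ _ < _
  rw [h3, h4]
  simp [runningSup]

theorem eventually_epoch (hX : IsRegenerative P X c)
    (hT : Integrable (fun ω => ((c 0 ω).duration : ℝ)) P) (hα : 0 < meanDuration P c) :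
    ∀ᵐ ω ∂P, (∀ᶠ n : ℕ in atTop, meanDuration P c * n / 2 ≤ epoch c n ω) ∧
      ∀ᶠ n : ℕ in atTop, epoch c n ω ≤ 2 * meanDuration P c * n := by
  filter_upwards [hX.tendsto_epoch_div hT] with ω hω
  constructor
  · filter_upwards [hω.eventually_const_lt (half_lt_self hα), eventually_gt_atTop 0] with n hn hn0
    have : (0 : ℝ) < n := by exact_mod_cast hn0
    rw [lt_div_iff₀ this] at hn
    linarith
  · filter_upwards [hω.eventually_lt_const (show _ < 2 * meanDuration P c by linarith),
      eventually_gt_atTop 0] with n hn hn0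
    have : (0 : ℝ) < n := by exact_mod_cast hn0
    rw [div_lt_iff₀ this] at hn
    exact hn.le

end IsRegenerative

/-- Tails whose exponent `-log` tends to infinity are positive. -/
theorem pos_of_tendsto_neg_log {Q : ℝ → ℝ} (hQ : Antitone Q) (hQ0 : ∀ x, 0 ≤ Q x)
    (h : Tendsto (fun k : ℕ => -Real.log (Q k)) atTop atTop) (x : ℝ) : 0 < Q x := by
  refine lt_of_le_of_ne (hQ0 x) fun h0 => ?_
  obtain ⟨k, hk, hxk⟩ := ((h.eventually_gt_atTop 0).and
    (tendsto_natCast_atTop_atTop.eventually_ge_atTop x)).exists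
  have h1 : Q k = 0 := le_antisymm ((hQ hxk).trans h0.ge) (hQ0 _)
  -- `Real.log 0 = 0`, so a vanishing tail would give exponent `0`, which is not positive.
  simp [h1] at hk

theorem exists_nat_add_one_div_lt {a b : ℝ} (h : a < b) : ∃ n : ℕ, a + 1 / ((n : ℝ) + 1) < b := by
  obtain ⟨n, hn⟩ := exists_nat_one_div_lt (sub_pos.2 h)
  exact ⟨n, by linarith⟩

theorem theorem2 {Ω : Type*} [MeasurableSpace Ω] (P : Measure Ω) [IsProbabilityMeasure P]
    (X : ℝ≥0 → Ω → ℝ) (c : ℕ → Ω → RegenCycle) (hX : IsRegenerative P X c)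
    (hlattice : ∀ t : ℝ≥0, ∀ᵐ ω ∂P, ∃ n : ℕ, X t ω = n)
    (R₀ R₁ : ℝ → ℝ) (C₁ : ℝ)
    (hdecomp : ∀ k : ℕ, tailExponent P X c k = R₀ k + R₁ k)
    (hR₁ : ∀ k : ℕ, |R₁ k| ≤ C₁)
    (hR₀ : ConditionU R₀)
    (hT : Integrable (fun ω => ((c 0 ω).duration : ℝ)) P) :
    ((fun x : ℝ => deriv R₀ (genInv R₀ x)) =o[atTop] (fun x : ℝ => Real.log x) →
      ∀ᵐ ω ∂P, limsup
        (normalizedSup R₀ (meanDuration P c) L₂ (fun s => X s ω)) atTop = (1 : EReal)) ∧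
    ((fun x : ℝ => deriv R₀ (genInv R₀ x)) =o[atTop] (fun x : ℝ => Real.log (Real.log x)) →
      ∀ᵐ ω ∂P, liminf
        (normalizedSup R₀ (meanDuration P c) L₃ (fun s => X s ω)) atTop = (-1 : EReal)) := by
  obtain ⟨M, hMm, hind, hid, hMae⟩ := hX.exists_cycleMax
  have hM0 : ∀ᵐ ω ∂P, M 0 ω = runningSup (c 0 ω).path (c 0 ω).duration :=
    hMae.mono fun ω h => h 0
  set Q : ℝ → ℝ := fun x => P.real {ω | (x : EReal) < M 0 ω} with hQdef
  have hQ : Antitone Q := fun x y hxy =>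
    measureReal_mono fun ω (hω : (y : EReal) < M 0 ω) =>
      (EReal.coe_le_coe_iff.2 hxy).trans_lt hω
  have hlog : ∀ k : ℕ, -Real.log (Q k) = R₀ k + R₁ k := fun k => by
    rw [← hdecomp, hX.tailExponent_eq hM0]
  have hpos : ∀ x, 0 < Q x := by
    refine pos_of_tendsto_neg_log hQ (fun _ => measureReal_nonneg) ?_
    simp_rw [hlog]
    exact tendsto_atTop_add_right_of_le _ (-C₁) (hR₀.tendsto.comp tendsto_natCast_atTop_atTop)
      fun k => (abs_le.1 (hR₁ k)).1
  have hQR : ∀ k : ℕ, Q k = Real.exp (-(R₀ k + R₁ k)) := fun k => by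
    rw [← hlog, neg_neg, Real.exp_log (hpos _)]
  have hα : 0 < meanDuration P c := IsRegenerative.meanDuration_pos hT hM0 (hpos 0)
  have hepoch := hX.eventually_epoch hT hα
  obtain ⟨x₀, hmono, -⟩ := hR₀.eventually_mono_diff
  have hy := tendsto_log_div_atTop hα
  have hlogt : Tendsto (fun t : ℝ≥0 => Real.log t) atTop atTop :=
    Real.tendsto_log_atTop.comp (NNReal.tendsto_coe_atTop.2 tendsto_id)
  refine ⟨fun hlo => ?_, fun hlo => ?_⟩
  · have hl := isScale_log
    have hg := hR₀.slowGrowth hl hlo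
    have htail := hg.hasTail hl hmono (hR₀.eventually_apply_genInv (hg.tendsto_atTop hl)) hQ hQR hR₁
    have hr : ∀ᶠ t : ℝ≥0 in atTop, 0 ≤ deriv R₀ (centering R₀ (meanDuration P c) t) :=
      (hy.eventually hg.pos).mono fun t ht => (one_div_pos.1 ht).le
    have hL : ∀ᶠ t : ℝ≥0 in atTop, 0 ≤ L₂ t := (hl.tendsto.comp hlogt).eventually_ge_atTop 0
    -- Restricting `ε` to `1 / (n + 1)` leaves a single null set to discard.
    have hup := ae_all_iff.2 fun n : ℕ =>
      ae_eventually_max_le hid htail (Nat.one_div_pos_of_nat (n := n))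
    have hdown := ae_all_iff.2 fun n : ℕ =>
      ae_frequently_lt_max hMm hind hid htail (Nat.one_div_pos_of_nat (n := n))
    filter_upwards [hMae, hX.eq_cycle, hepoch, hup, hdown] with ω hMω hx hS hup hdown
    simp_rw [hMω] at hup hdown
    rw [← EReal.coe_one]
    refine limsup_eq_of_bounds (tendsto_normalized hg hl hα fun _ => rfl) (fun b hb => ?_)
      fun b hb => ?_
    · obtain ⟨n, hn⟩ := exists_nat_add_one_div_lt hb
      filter_upwards [eventually_runningSup_le hg hl hα hx hS.1 hn (hup n), hr, hL] with t h1 h2 h3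
      exact normalizedSup_le h2 h3 h1
    · obtain ⟨n, hn⟩ := exists_nat_add_one_div_lt hb
      refine ((frequently_le_runningSup hg hl hα hx hS.2 (lt_sub_iff_add_lt.2 hn)
        (hdown n)).and_eventually (hr.and hL)).mono fun t h => ?_
      exact le_normalizedSup h.2.1 h.2.2 h.1
  · have hl := isScale_log_log
    have hg := hR₀.slowGrowth hl hlo
    have htail := hg.hasTail hl hmono (hR₀.eventually_apply_genInv (hg.tendsto_atTop hl)) hQ hQR hR₁
    have hr : ∀ᶠ t : ℝ≥0 in atTop, 0 ≤ deriv R₀ (centering R₀ (meanDuration P c) t) :=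
      (hy.eventually hg.pos).mono fun t ht => (one_div_pos.1 ht).le
    have hL : ∀ᶠ t : ℝ≥0 in atTop, 0 ≤ L₃ t := (hl.tendsto.comp hlogt).eventually_ge_atTop 0
    have hup := ae_all_iff.2 fun n : ℕ =>
      ae_eventually_lt_max hMm hind hid htail (Nat.one_div_pos_of_nat (n := n))
    have hdown := ae_all_iff.2 fun n : ℕ =>
      ae_frequently_max_le hMm hind hid htail (Nat.one_div_pos_of_nat (n := n))
    filter_upwards [hMae, hX.eq_cycle, hepoch, hup, hdown] with ω hMω hx hS hup hdown
    simp_rw [hMω] at hup hdown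
    rw [← EReal.coe_one, ← EReal.coe_neg]
    refine liminf_eq_of_bounds (tendsto_normalized hg hl hα fun _ => rfl) (fun b hb => ?_)
      fun b hb => ?_
    · obtain ⟨n, hn⟩ := exists_nat_add_one_div_lt hb
      filter_upwards [eventually_le_runningSup hg hl hα hx hS.2 (lt_sub_iff_add_lt.2 hn) (hup n),
        hr, hL] with t h1 h2 h3
      exact le_normalizedSup h2 h3 h1
    · obtain ⟨n, hn⟩ := exists_nat_add_one_div_lt hb
      refine ((frequently_runningSup_le hg hl hα hx hS.1 hn
        (hdown n)).and_eventually (hr.and hL)).mono fun t h => ?_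
      exact normalizedSup_le h.2.1 h.2.2 h.1
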